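/- Work in classical two-sorted first-order logic in the language of second-order arithmetic (number variables, set variables, $0,1,+,\cdot,=,<,\in$). Let $\mathsf{RCA}_0$ be the theory whose axioms are the basic axioms of arithmetic ($n+1\neq 0$; $m+1=n+1\to m=n$; $m+0=m$; $m+(n+1)=(m+n)+1$; $m\cdot 0=0$; $m\cdot(n+1)=m\cdot n+m$; $\neg\, m<0$; $m<n+1\leftrightarrow(m<n\vee m=n)$), the induction scheme $\big(\varphi(0)\wedge\forall n(\varphi(n)\to\varphi(n+1))\big)\to\forall n\,\varphi(n)$ for $\Sigma^0_1$ formulas $\varphi$, and the comprehension scheme $\forall n(\varphi(n)\leftrightarrow\psi(n))\to\exists X\,\forall n(n\in X\leftrightarrow\varphi(n))$ for $\Sigma^0_1$ formulas $\varphi$ and $\Pi^0_1$ formulas $\psi$, where number and set parameters are allowed and $X$ is not free in $\varphi$. Let $\mathsf{RT}_2^2$ be the sentence stating that for every colouring $f:[\mathbb{N}]^2\to\{1,2\}$ of the two-element sets of natural numbers there is an infinite set $H\subseteq\mathbb{N}$ such that $f$ is constant on $[H]^2$. Let $\mathsf{WKL}$ be the sentence (weak König's lemma) stating that every infinite tree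 $T\subseteq 2^{<\mathbb{N}}$ has an infinite path. (Functions and finite sequences are represented by sets and numbers through the usual codings of pairs and of finite sets.) Then $\mathsf{RCA}_0+\mathsf{RT}_2^2$ does not prove $\mathsf{WKL}$; that is, $\mathsf{RT}_2^2$ does not imply $\mathsf{WKL}_0$ over $\mathsf{RCA}_0$. -/

import Mathlib

/-! Second-order arithmetic: its two-sorted language, classical derivability, the system `RCA₀`, and
the sentences expressing Ramsey's theorem for pairs and two colours and weak König's lemma. -/

namespace SOA

/-- Number terms of the language of second-order arithmetic; `var n` is the `n`-th number variable
(a de Bruijn index). -/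
inductive Term : Type
  | var : ℕ → Term
  | zero : Term
  | one : Term
  | add : Term → Term → Term
  | mul : Term → Term → Term

instance : Zero Term := ⟨Term.zero⟩
instance : One Term := ⟨Term.one⟩
instance : Add Term := ⟨Term.add⟩
instance : Mul Term := ⟨Term.mul⟩

/-- Simultaneous substitution of terms for the number variables. -/
def Term.subst (σ : ℕ → Term) : Term → Term
  | .var n => σ n
  | .zero => .zero
  | .one => .one
  | .add t u => .add (t.subst σ) (u.subst σ)
  | .mul t u => .mul (t.subst σ) (u.subst σ)

/-- `t.shift k` is the term `t` read below `k` further number quantifiers. -/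
def Term.shift (k : ℕ) (t : Term) : Term := t.subst fun n => .var (n + k)

/-- Formulas of the language of second-order arithmetic. The atomic formulas are `t = u`, `t < u` and
`t ∈ X_n`. Number variables and set variables are two separate families of de Bruijn indices: `allN`
binds number variable `0`, and `allS` binds set variable `0`. The other connectives and the
existential quantifiers are the usual classical abbreviations. -/
inductive Fml : Type
  | eq : Term → Term → Fml
  | lt : Term → Term → Fml
  | mem : Term → ℕ → Fml
  | fls : Fml
  | imp : Fml → Fml → Fml
  | allN : Fml → Fml
  | allS : Fml → Fml

infix:62 " =ₙ " => Fml.eq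
infix:62 " <ₙ " => Fml.lt
infix:62 " ∈ₛ " => Fml.mem
infixr:50 " ⇒ₗ " => Fml.imp

namespace Fml

def neg (φ : Fml) : Fml := φ ⇒ₗ fls
def and (φ ψ : Fml) : Fml := neg (φ ⇒ₗ neg ψ)
def or (φ ψ : Fml) : Fml := neg φ ⇒ₗ ψ
def iff (φ ψ : Fml) : Fml := and (φ ⇒ₗ ψ) (ψ ⇒ₗ φ)
def exN (φ : Fml) : Fml := neg (allN (neg φ))
def exS (φ : Fml) : Fml := neg (allS (neg φ))

end Fml

infixr:60 " ∧ₗ " => Fml.and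
infixr:55 " ∨ₗ " => Fml.or
infix:45 " ⇔ₗ " => Fml.iff

/-- The sequence `a, f 0, f 1, …`. -/
def cons {α : Type} (a : α) (f : ℕ → α) : ℕ → α
  | 0 => a
  | n + 1 => f n

namespace Fml

/-- Simultaneous capture-avoiding substitution of the terms `σ n` for the number variables and of the
set variables `ρ n` for the set variables. -/
def subst : (ℕ → Term) → (ℕ → ℕ) → Fml → Fml
  | σ, _, eq t u => eq (t.subst σ) (u.subst σ)
  | σ, _, lt t u => lt (t.subst σ) (u.subst σ)
  | σ, ρ, mem t n => mem (t.subst σ) (ρ n)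
  | _, _, fls => fls
  | σ, ρ, imp φ ψ => imp (φ.subst σ ρ) (ψ.subst σ ρ)
  | σ, ρ, allN φ => allN (φ.subst (cons (.var 0) fun n => (σ n).shift 1) ρ)
  | σ, ρ, allS φ => allS (φ.subst σ (cons 0 fun n => ρ n + 1))

/-- `φ` read below one further number quantifier. -/
def liftN (φ : Fml) : Fml := φ.subst (fun n => .var (n + 1)) id

/-- `φ` read below one further set quantifier. -/
def liftS (φ : Fml) : Fml := φ.subst .var (· + 1)

/-- The instance `φ(t)` of the body `φ` of a number quantifier. -/
def instN (φ : Fml) (t : Term) : Fml := φ.subst (cons t .var) id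

/-- The instance `φ(X_n)` of the body `φ` of a set quantifier. -/
def instS (φ : Fml) (n : ℕ) : Fml := φ.subst .var (cons n id)

end Fml

open Term Fml

/-- `Provable T φ`: the formula `φ` is derivable from the set `T` of axioms in a Hilbert calculus for
classical two-sorted predicate logic with equality between numbers. Free variables in axioms are read
universally. -/
inductive Provable (T : Set Fml) : Fml → Prop
  | ax {φ} : φ ∈ T → Provable T φ
  | mp {φ ψ} : Provable T (φ ⇒ₗ ψ) → Provable T φ → Provable T ψ
  | genN {φ} : Provable T φ → Provable T (allN φ)
  | genS {φ} : Provable T φ → Provable T (allS φ)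
  | weaken (φ ψ) : Provable T (φ ⇒ₗ ψ ⇒ₗ φ)
  | distrib (φ ψ χ) : Provable T ((φ ⇒ₗ ψ ⇒ₗ χ) ⇒ₗ (φ ⇒ₗ ψ) ⇒ₗ φ ⇒ₗ χ)
  | dne (φ) : Provable T (neg (neg φ) ⇒ₗ φ)
  | specN (φ : Fml) (t) : Provable T (allN φ ⇒ₗ φ.instN t)
  | specS (φ : Fml) (n) : Provable T (allS φ ⇒ₗ φ.instS n)
  | allN_imp (φ ψ) : Provable T (allN (φ ⇒ₗ ψ) ⇒ₗ allN φ ⇒ₗ allN ψ)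
  | allS_imp (φ ψ) : Provable T (allS (φ ⇒ₗ ψ) ⇒ₗ allS φ ⇒ₗ allS ψ)
  | vacN (φ : Fml) : Provable T (φ ⇒ₗ allN φ.liftN)
  | vacS (φ : Fml) : Provable T (φ ⇒ₗ allS φ.liftS)
  | eq_refl (t) : Provable T (t =ₙ t)
  | eq_subst (φ : Fml) (t u) : Provable T (t =ₙ u ⇒ₗ φ.instN t ⇒ₗ φ.instN u)

/-- Bounded-quantifier (`Σ⁰₀`) formulas, possibly with free number and set variables. A bounded
existential quantifier is the dual of a bounded universal one. -/
inductive IsBounded : Fml → Prop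
  | eq (t u) : IsBounded (t =ₙ u)
  | lt (t u) : IsBounded (t <ₙ u)
  | mem (t n) : IsBounded (t ∈ₛ n)
  | fls : IsBounded fls
  | imp {φ ψ} : IsBounded φ → IsBounded ψ → IsBounded (φ ⇒ₗ ψ)
  | ball (t : Term) {φ} : IsBounded φ → IsBounded (allN (var 0 <ₙ t.shift 1 ⇒ₗ φ))

/-- `Σ⁰₁` formulas. -/
def IsSigma1 (φ : Fml) : Prop := ∃ θ, IsBounded θ ∧ φ = exN θ

/-- `Π⁰₁` formulas. -/
def IsPi1 (φ : Fml) : Prop := ∃ θ, IsBounded θ ∧ φ = allN θ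

/-- The axioms of `RCA₀`: the basic axioms of arithmetic, induction for `Σ⁰₁` formulas, and
comprehension for `Δ⁰₁` formulas, both with arbitrary number and set parameters. In the two schemes
the distinguished variable is number variable `0` of `φ` and `ψ`. -/
inductive RCA0 : Set Fml
  | succ_ne_zero : RCA0 (neg (var 0 + 1 =ₙ 0))
  | succ_inj : RCA0 (var 0 + 1 =ₙ var 1 + 1 ⇒ₗ var 0 =ₙ var 1)
  | add_zero : RCA0 (var 0 + 0 =ₙ var 0)
  | add_succ : RCA0 (var 0 + (var 1 + 1) =ₙ (var 0 + var 1) + 1)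
  | mul_zero : RCA0 (var 0 * 0 =ₙ 0)
  | mul_succ : RCA0 (var 0 * (var 1 + 1) =ₙ var 0 * var 1 + var 0)
  | not_lt_zero : RCA0 (neg (var 0 <ₙ 0))
  | lt_succ : RCA0 (var 0 <ₙ var 1 + 1 ⇔ₗ (var 0 <ₙ var 1 ∨ₗ var 0 =ₙ var 1))
  | sigma1_induction (φ : Fml) : IsSigma1 φ →
      RCA0 (φ.instN 0 ∧ₗ allN (φ ⇒ₗ φ.subst (cons (var 0 + 1) fun n => var (n + 1)) id) ⇒ₗ allN φ)
  | delta1_comprehension (φ ψ : Fml) : IsSigma1 φ → IsPi1 ψ →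
      RCA0 (allN (φ ⇔ₗ ψ) ⇒ₗ exS (allN (var 0 ∈ₛ 0 ⇔ₗ φ.liftS)))

/-- The code `(t + u)² + t` of the ordered pair `(t, u)`. -/
def pair (t u : Term) : Term := (t + u) * (t + u) + t

/-- The set `X` is infinite (unbounded): `∀ n ∃ m (n < m ∧ m ∈ X)`. -/
def infinite (X : ℕ) : Fml := allN (exN (var 1 <ₙ var 0 ∧ₗ var 0 ∈ₛ X))

/-- `φ` or `ψ`, but not both. -/
def exactlyOne (φ ψ : Fml) : Fml := (φ ∨ₗ ψ) ∧ₗ neg (φ ∧ₗ ψ)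

/-! ### Ramsey's theorem for pairs and two colours -/

/-- The set `F` is (the graph of) a function from `[ℕ]²` to `{1, 2}`, where `[ℕ]²` is the set of pairs
`(x, y)` with `x < y`: every element of `F` is of the form `((x, y), c)` with `x < y` and `c` one of
`1`, `2`, and for all `x < y` there is exactly one such `c`. -/
def isColoring (F : ℕ) : Fml :=
  allN (var 0 ∈ₛ F ⇒ₗ exN (exN (var 1 <ₙ var 0 ∧ₗ
    (var 2 =ₙ pair (pair (var 1) (var 0)) 1 ∨ₗ var 2 =ₙ pair (pair (var 1) (var 0)) (1 + 1)))))
  ∧ₗ allN (allN (var 1 <ₙ var 0 ⇒ₗ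
    exactlyOne (pair (pair (var 1) (var 0)) 1 ∈ₛ F) (pair (pair (var 1) (var 0)) (1 + 1) ∈ₛ F)))

/-- `H` is homogeneous for the colouring `F`: some colour `c` is the colour of all pairs `x < y` of
elements of `H`. -/
def isHomogeneous (H F : ℕ) : Fml :=
  exN (allN (allN (var 1 ∈ₛ H ∧ₗ var 0 ∈ₛ H ∧ₗ var 1 <ₙ var 0 ⇒ₗ
    pair (pair (var 1) (var 0)) (var 2) ∈ₛ F)))

/-- Every 2-colouring of `[ℕ]²` has an infinite homogeneous set. -/
def RT22 : Fml := allS (isColoring 0 ⇒ₗ exS (infinite 0 ∧ₗ isHomogeneous 0 1))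

/-! ### Weak König's lemma

A triple `(k, (m, n))` represents the finite set of all `i < k` such that `m(i+1)+1` divides `n`. The
code of a finite set is the least triple that represents it, and a finite binary sequence is
identified with its graph, a finite set of pairs `(i, b)`. -/

/-- `s` is of the form `(k, (m, n))`. -/
def isTriple (s : Term) : Fml :=
  exN (exN (exN (s.shift 3 =ₙ pair (var 2) (pair (var 1) (var 0)))))

/-- `x` belongs to the finite set represented by `s`: there are `k, m, n, q` such that
`s = (k, (m, n))`, `x < k` and `q (m (x + 1) + 1) = n`. -/
def elem (x s : Term) : Fml :=
  exN (exN (exN (exN (s.shift 4 =ₙ pair (var 3) (pair (var 2) (var 1)) ∧ₗ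
    x.shift 4 <ₙ var 3 ∧ₗ var 0 * (var 2 * (x.shift 4 + 1) + 1) =ₙ var 1))))

/-- `s` is the code of a finite set. -/
def isFinCode (s : Term) : Fml :=
  isTriple s ∧ₗ allN (var 0 <ₙ s.shift 1 ⇒ₗ isTriple (var 0) ⇒ₗ
    neg (allN (elem (var 0) (var 1) ⇔ₗ elem (var 0) (s.shift 2))))

/-- `s` is the code of a binary sequence of length `l`. -/
def isBinSeq (s l : Term) : Fml :=
  isFinCode s
  ∧ₗ allN (elem (var 0) (s.shift 1) ⇒ₗ exN (var 0 <ₙ l.shift 2 ∧ₗ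
      (var 1 =ₙ pair (var 0) 0 ∨ₗ var 1 =ₙ pair (var 0) 1)))
  ∧ₗ allN (var 0 <ₙ l.shift 1 ⇒ₗ
      exactlyOne (elem (pair (var 0) 0) (s.shift 1)) (elem (pair (var 0) 1) (s.shift 1)))

/-- The set `T` is a binary tree: a set of (codes of) finite binary sequences, closed under initial
segments. A sequence is an initial segment of another one iff its graph is a subset of the graph of
the other. -/
def isTree (T : ℕ) : Fml :=
  allN (var 0 ∈ₛ T ⇒ₗ exN (isBinSeq (var 1) (var 0)))
  ∧ₗ allN (allN (var 1 ∈ₛ T ∧ₗ exN (isBinSeq (var 1) (var 0)) ∧ₗ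
      allN (elem (var 0) (var 1) ⇒ₗ elem (var 0) (var 2)) ⇒ₗ var 0 ∈ₛ T))

/-- The set `P` is (the graph of) a function from `ℕ` to `{0, 1}`. -/
def isBinFun (P : ℕ) : Fml :=
  allN (var 0 ∈ₛ P ⇒ₗ exN (var 1 =ₙ pair (var 0) 0 ∨ₗ var 1 =ₙ pair (var 0) 1))
  ∧ₗ allN (exactlyOne (pair (var 0) 0 ∈ₛ P) (pair (var 0) 1 ∈ₛ P))

/-- `P` is an infinite path through the tree `T`: a function from `ℕ` to `{0, 1}` whose initial segment
of each length `l` belongs to `T`. -/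
def isPath (P T : ℕ) : Fml :=
  isBinFun P ∧ₗ allN (exN (isBinSeq (var 0) (var 1) ∧ₗ
    allN (elem (var 0) (var 1) ⇒ₗ var 0 ∈ₛ P) ∧ₗ var 0 ∈ₛ T))

/-- Every infinite binary tree has an infinite path. -/
def WKL : Fml := allS (isTree 0 ∧ₗ infinite 0 ⇒ₗ exS (isPath 0 1))

end SOA

/-! ### ω-models and soundness -/

namespace SOA

/-! By soundness it suffices to find an ω-model of `RCA0` and `RT22` in which `WKL` fails. Its sets
are those computable in some term of an increasing sequence of oracles (`exists_oracles`), none of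
which computes a total 0-1-valued function avoiding the partial diagonal function `Diag` (this is
`NonSep`). Such a family satisfies `RCA0`. It refutes `WKL`: the finite strings that avoid the
diagonal values found so far form a computable infinite tree, and each path through it is a
forbidden function (`not_true_WKL`). What remains is that every colouring computable in a `NonSep`
oracle has an infinite homogeneous set computable in a stronger `NonSep` oracle
(`exists_homogeneous`).

A set `C` cohesive for the rows of the colouring, obtained by Mathias forcing (`exists_cohesive`),
gives each `x ∈ C` a limit colour, and so splits `C` into `A false` and `A true`. These need not be
computable, but `exists_monochromatic` holds for every partition: one side has an infinite subset
`G` that preserves `NonSep`. Thinning `G` greedily yields the homogeneous set.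

For `exists_monochromatic`, subsets of both sides are built at once, and for every pair of
functionals one of the two must fail. As the partition is not computable, the argument quantifies
over all partitions; this is a compact space, so enumerability survives (`Sig.forall_seq`). Consider
the finite lists of guesses that are contradicted under every partition. If a correct list occurs,
the true partition provides a string on which a functional returns a diagonal value
(`settle_of_correct`). If none occurs, `NonSep` yields a tuple of places all of whose `2 ^ N` lists
of guesses can be left uncontradicted (`exists_tuple_avoiding`). Amalgamating the witnesses and
applying the pigeonhole principle covers `C` by reservoirs on each of which a functional is
undefined at some place (`settle_of_avoiding`). This covering is why a condition has finitely many
parts and a `Π⁰₁` class of sequences. A Baire category argument (`exists_acc`) and König's lemma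
(`exists_branch`) select a branch of parts along which both sets can grow. -/

/-- The value of a term in the standard model of arithmetic. -/
def Term.val (ν : ℕ → ℕ) : Term → ℕ
  | .var n => ν n
  | .zero => 0
  | .one => 1
  | .add t u => t.val ν + u.val ν
  | .mul t u => t.val ν * u.val ν

/-- Truth in the ω-model whose sets are the members of `I`. -/
def Fml.True (I : Set (Set ℕ)) : Fml → (ℕ → ℕ) → (ℕ → Set ℕ) → Prop
  | .eq t u, ν, _ => t.val ν = u.val ν
  | .lt t u, ν, _ => t.val ν < u.val ν
  | .mem t n, ν, μ => t.val ν ∈ μ n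
  | .fls, _, _ => False
  | .imp φ ψ, ν, μ => φ.True I ν μ → ψ.True I ν μ
  | .allN φ, ν, μ => ∀ x, φ.True I (cons x ν) μ
  | .allS φ, ν, μ => ∀ B ∈ I, φ.True I ν (cons B μ)

section
variable {I : Set (Set ℕ)} {ν : ℕ → ℕ} {μ : ℕ → Set ℕ}

@[simp] theorem val_var (n : ℕ) : (Term.var n).val ν = ν n := rfl
@[simp] theorem val_zero : (0 : Term).val ν = 0 := rfl
@[simp] theorem val_one : (1 : Term).val ν = 1 := rfl
@[simp] theorem val_add (t u : Term) : (t + u).val ν = t.val ν + u.val ν := rfl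
@[simp] theorem val_mul (t u : Term) : (t * u).val ν = t.val ν * u.val ν := rfl
@[simp] theorem cons_zero {α : Type} (a : α) (f : ℕ → α) : cons a f 0 = a := rfl
@[simp] theorem cons_succ {α : Type} (a : α) (f : ℕ → α) (n : ℕ) : cons a f (n + 1) = f n := rfl
@[simp] theorem cons_one {α : Type} (a : α) (f : ℕ → α) : cons a f 1 = f 0 := rfl
@[simp] theorem cons_two {α : Type} (a : α) (f : ℕ → α) : cons a f 2 = f 1 := rfl
@[simp] theorem cons_three {α : Type} (a : α) (f : ℕ → α) : cons a f 3 = f 2 := rfl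

theorem cons_comp {α β : Type} (g : α → β) (a : α) (f : ℕ → α) :
    (fun n => g (cons a f n)) = cons (g a) fun n => g (f n) := by
  funext n; cases n <;> rfl

theorem val_subst (σ : ℕ → Term) (t : Term) : (t.subst σ).val ν = t.val fun n => (σ n).val ν := by
  induction t with
  | var n => rfl
  | zero => rfl
  | one => rfl
  | add t u iht ihu => simp only [Term.subst, Term.val, iht, ihu]
  | mul t u iht ihu => simp only [Term.subst, Term.val, iht, ihu]

theorem val_shift (k : ℕ) (t : Term) : (t.shift k).val ν = t.val fun n => ν (n + k) :=
  val_subst _ _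

@[simp] theorem val_shift_one (t : Term) (x : ℕ) : (t.shift 1).val (cons x ν) = t.val ν :=
  val_shift _ _
@[simp] theorem val_shift_two (t : Term) (x y : ℕ) :
    (t.shift 2).val (cons x (cons y ν)) = t.val ν := val_shift _ _
@[simp] theorem val_shift_three (t : Term) (x y z : ℕ) :
    (t.shift 3).val (cons x (cons y (cons z ν))) = t.val ν := val_shift _ _
@[simp] theorem val_shift_four (t : Term) (x y z w : ℕ) :
    (t.shift 4).val (cons x (cons y (cons z (cons w ν)))) = t.val ν := val_shift _ _

theorem true_subst (φ : Fml) : ∀ (σ : ℕ → Term) (ρ : ℕ → ℕ) (ν : ℕ → ℕ) (μ : ℕ → Set ℕ),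
    (φ.subst σ ρ).True I ν μ ↔ φ.True I (fun n => (σ n).val ν) fun n => μ (ρ n) := by
  induction φ with
  | eq t u => intro σ ρ ν μ; simp only [Fml.subst, Fml.True, val_subst]
  | lt t u => intro σ ρ ν μ; simp only [Fml.subst, Fml.True, val_subst]
  | mem t n => intro σ ρ ν μ; simp only [Fml.subst, Fml.True, val_subst]
  | fls => intro σ ρ ν μ; rfl
  | imp φ ψ ihφ ihψ => intro σ ρ ν μ; simp only [Fml.subst, Fml.True, ihφ, ihψ]
  | allN φ ih =>
    intro σ ρ ν μ
    simp only [Fml.subst, Fml.True, ih]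
    refine forall_congr' fun x => ?_
    rw [cons_comp (fun t : Term => t.val (cons x ν))]
    simp
  | allS φ ih =>
    intro σ ρ ν μ
    simp only [Fml.subst, Fml.True, ih]
    refine forall_congr' fun B => forall_congr' fun _ => ?_
    rw [cons_comp (cons B μ)]
    simp

@[simp] theorem true_eq (t u : Term) : (t =ₙ u).True I ν μ ↔ t.val ν = u.val ν := Iff.rfl
@[simp] theorem true_lt (t u : Term) : (t <ₙ u).True I ν μ ↔ t.val ν < u.val ν := Iff.rfl
@[simp] theorem true_mem (t : Term) (n : ℕ) : (t ∈ₛ n).True I ν μ ↔ t.val ν ∈ μ n := Iff.rfl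
@[simp] theorem true_fls : Fml.fls.True I ν μ ↔ False := Iff.rfl
@[simp] theorem true_imp (φ ψ : Fml) :
    (φ ⇒ₗ ψ).True I ν μ ↔ (φ.True I ν μ → ψ.True I ν μ) := Iff.rfl
@[simp] theorem true_allN (φ : Fml) :
    (Fml.allN φ).True I ν μ ↔ ∀ x, φ.True I (cons x ν) μ := Iff.rfl
@[simp] theorem true_allS (φ : Fml) :
    (Fml.allS φ).True I ν μ ↔ ∀ B ∈ I, φ.True I ν (cons B μ) := Iff.rfl
@[simp] theorem true_neg (φ : Fml) : φ.neg.True I ν μ ↔ ¬φ.True I ν μ := Iff.rfl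
@[simp] theorem true_and (φ ψ : Fml) : (φ ∧ₗ ψ).True I ν μ ↔ φ.True I ν μ ∧ ψ.True I ν μ := by
  simp [Fml.and]
@[simp] theorem true_or (φ ψ : Fml) : (φ ∨ₗ ψ).True I ν μ ↔ φ.True I ν μ ∨ ψ.True I ν μ := by
  simp only [Fml.or, true_imp, true_neg]; tauto
@[simp] theorem true_iff (φ ψ : Fml) :
    (φ ⇔ₗ ψ).True I ν μ ↔ (φ.True I ν μ ↔ ψ.True I ν μ) := by
  simp only [Fml.iff, true_and, true_imp]; tauto
@[simp] theorem true_exN (φ : Fml) :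
    (Fml.exN φ).True I ν μ ↔ ∃ x, φ.True I (cons x ν) μ := by
  simp [Fml.exN]
@[simp] theorem true_exS (φ : Fml) :
    (Fml.exS φ).True I ν μ ↔ ∃ B ∈ I, φ.True I ν (cons B μ) := by
  simp [Fml.exS]

theorem true_instN (φ : Fml) (t : Term) :
    (φ.instN t).True I ν μ ↔ φ.True I (cons (t.val ν) ν) μ := by
  rw [Fml.instN, true_subst, cons_comp (fun t : Term => t.val ν)]; rfl
theorem true_instS (φ : Fml) (n : ℕ) :
    (φ.instS n).True I ν μ ↔ φ.True I ν (cons (μ n) μ) := by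
  rw [Fml.instS, true_subst, cons_comp μ]; rfl
theorem true_liftN (φ : Fml) (x : ℕ) : φ.liftN.True I (cons x ν) μ ↔ φ.True I ν μ := by
  rw [Fml.liftN, true_subst]; rfl
theorem true_liftS (φ : Fml) (B : Set ℕ) : φ.liftS.True I ν (cons B μ) ↔ φ.True I ν μ := by
  rw [Fml.liftS, true_subst]; rfl

end

/-- Soundness of the calculus for ω-models. -/
theorem Provable.sound {I : Set (Set ℕ)} {T : Set Fml}
    (hT : ∀ φ ∈ T, ∀ ν μ, (∀ n, μ n ∈ I) → φ.True I ν μ) {φ : Fml} (h : Provable T φ) :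
    ∀ ν μ, (∀ n, μ n ∈ I) → φ.True I ν μ := by
  induction h with
  | ax h => exact hT _ h
  | mp _ _ ih₁ ih₂ => exact fun ν μ hμ => ih₁ ν μ hμ (ih₂ ν μ hμ)
  | genN _ ih => exact fun ν μ hμ x => ih _ _ hμ
  | genS _ ih =>
    refine fun ν μ hμ B hB => ih _ _ fun n => ?_
    cases n
    · exact hB
    · exact hμ _
  | weaken φ ψ => exact fun ν μ _ h _ => h
  | distrib φ ψ χ => exact fun ν μ _ h₁ h₂ h => h₁ h (h₂ h)
  | dne φ => exact fun ν μ _ h => not_not.1 h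
  | specN φ t => exact fun ν μ _ h => (true_instN φ t).2 (h _)
  | specS φ n => exact fun ν μ hμ h => (true_instS φ n).2 (h _ (hμ n))
  | allN_imp φ ψ => exact fun ν μ _ h₁ h₂ x => h₁ x (h₂ x)
  | allS_imp φ ψ => exact fun ν μ _ h₁ h₂ x hx => h₁ x hx (h₂ x hx)
  | vacN φ => exact fun ν μ _ h x => (true_liftN φ x).2 h
  | vacS φ => exact fun ν μ _ h B _ => (true_liftS φ B).2 h
  | eq_refl t => exact fun ν μ _ => rfl
  | eq_subst φ t u =>
    intro ν μ _ h h'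
    have h : t.val ν = u.val ν := h
    rw [true_instN] at h' ⊢
    rwa [← h]

end SOA

/-! ### Relations that are `Σ⁰₁` in an oracle -/

namespace SOA

section Sigma

variable {α β γ : Type} [Primcodable α] [Primcodable β] [Primcodable γ]

/-- The initial segment of length `n` of a sequence. -/
def approx {α : Type} (X : ℕ → α) (n : ℕ) : List α := (List.range n).map X

@[simp] theorem length_approx {α : Type} (X : ℕ → α) (n : ℕ) : (approx X n).length = n := by
  simp [approx]

theorem getElem_approx {α : Type} (X : ℕ → α) (n i : ℕ) (h : i < (approx X n).length) :
    (approx X n)[i] = X i := by simp [approx]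

theorem take_approx {α : Type} (X : ℕ → α) {m n : ℕ} (h : m ≤ n) :
    (approx X n).take m = approx X m := by
  simp [approx, ← List.map_take, List.take_range, h]

theorem getD_approx {α : Type} (X : ℕ → α) {n i : ℕ} (h : i < n) (d : α) :
    (approx X n).getD i d = X i := by simp [approx, h]

theorem map_approx {α β : Type} (f : α → β) (X : ℕ → α) (n : ℕ) :
    (approx X n).map f = approx (fun i => f (X i)) n := by simp [approx]

theorem eq_approx_iff {α : Type} (X : ℕ → α) (s : List α) (d : α) :
    s = approx X s.length ↔ ∀ i ∈ List.range s.length, X i = s.getD i d := by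
  constructor
  · intro h i hi
    rw [h, getD_approx X (by simpa using hi)]
  · intro h
    apply List.ext_getElem (by simp)
    intro i h₁ h₂
    rw [getElem_approx, h i (by simpa using h₁)]
    simp [h₁]

theorem approx_congr {α : Type} {X Y : ℕ → α} {n : ℕ} (h : ∀ i < n, X i = Y i) :
    approx X n = approx Y n := by
  simpa [approx] using h

theorem eq_of_approx_eq {α : Type} {X Y : ℕ → α} {n : ℕ} (h : approx X n = approx Y n) :
    ∀ i < n, X i = Y i := by
  simpa [approx] using h

theorem primrec_exists_lt {R : ℕ → α → Prop} (h : PrimrecRel R) {f : α → ℕ} (hf : Primrec f) :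
    PrimrecPred fun a => ∃ k < f a, R k a :=
  (h.exists_mem_list.comp (Primrec.list_range.comp hf) Primrec.id).of_eq fun a => by simp

theorem primrec_forall_lt {R : ℕ → α → Prop} (h : PrimrecRel R) {f : α → ℕ} (hf : Primrec f) :
    PrimrecPred fun a => ∀ k < f a, R k a :=
  (h.forall_mem_list.comp (Primrec.list_range.comp hf) Primrec.id).of_eq fun a => by simp

/-- `P` is recursively enumerable in the oracle `X`: membership is witnessed by a finite initial
segment of `X`, in a primitive recursive way. -/
def Sig (X : ℕ → ℕ) (P : α → Prop) : Prop :=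
  ∃ R : α × List ℕ → Prop, PrimrecPred R ∧ ∀ a, P a ↔ ∃ n, R (a, approx X n)

variable {X Y Z : ℕ → ℕ} {P Q : α → Prop}

theorem Sig.of_iff (h : Sig X P) (H : ∀ a, Q a ↔ P a) : Sig X Q := by
  obtain ⟨R, hR, h⟩ := h
  exact ⟨R, hR, fun a => (H a).trans (h a)⟩

theorem Sig.of_primrec (h : PrimrecPred P) : Sig X P :=
  ⟨fun p => P p.1, h.comp Primrec.fst, fun a => by simp⟩

theorem Sig.comp {P : β → Prop} (h : Sig X P) {f : α → β} (hf : Primrec f) :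
    Sig X fun a => P (f a) := by
  obtain ⟨R, hR, h⟩ := h
  exact ⟨fun p => R (f p.1, p.2), hR.comp ((hf.comp Primrec.fst).pair Primrec.snd),
    fun a => h (f a)⟩

/-- Witnesses may be taken to persist to longer initial segments. -/
theorem Sig.normal (h : Sig X P) : ∃ R : α × List ℕ → Prop, PrimrecPred R ∧
    (∀ a, P a ↔ ∃ n, R (a, approx X n)) ∧
    ∀ a m n, m ≤ n → R (a, approx X m) → R (a, approx X n) := by
  obtain ⟨R, hR, h⟩ := h
  have key : ∀ a n, (∃ k < (approx X n).length + 1, R (a, (approx X n).take k)) ↔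
      ∃ k ≤ n, R (a, approx X k) := by
    intro a n
    simp only [length_approx, Nat.lt_succ_iff]
    exact exists_congr fun k => and_congr_right fun hk => by rw [take_approx X hk]
  refine ⟨fun p => ∃ k < p.2.length + 1, R (p.1, p.2.take k), ?_, fun a => ?_, fun a m n hmn => ?_⟩
  · have : PrimrecRel fun (k : ℕ) (p : α × List ℕ) => R (p.1, p.2.take k) :=
      hR.comp ((Primrec.fst.comp Primrec.snd).pair
        (Primrec.list_take.comp Primrec.fst (Primrec.snd.comp Primrec.snd)))
    exact primrec_exists_lt this (Primrec.succ.comp (Primrec.list_length.comp Primrec.snd))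
  · simp only [key, h]
    exact ⟨fun ⟨n, hn⟩ => ⟨n, n, le_rfl, hn⟩, fun ⟨_, k, _, hk⟩ => ⟨k, hk⟩⟩
  · simp only [key]
    exact fun ⟨k, hk, h⟩ => ⟨k, hk.trans hmn, h⟩

theorem Sig.and (hP : Sig X P) (hQ : Sig X Q) : Sig X fun a => P a ∧ Q a := by
  obtain ⟨R, hR, h, m⟩ := hP.normal
  obtain ⟨R', hR', h', m'⟩ := hQ.normal
  refine ⟨fun p => R p ∧ R' p, hR.and hR', fun a => ?_⟩
  simp only [h, h']
  exact ⟨fun ⟨⟨n, hn⟩, k, hk⟩ => ⟨max n k, m a _ _ (le_max_left _ _) hn,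
    m' a _ _ (le_max_right _ _) hk⟩, fun ⟨n, hn, hn'⟩ => ⟨⟨n, hn⟩, n, hn'⟩⟩

theorem Sig.or (hP : Sig X P) (hQ : Sig X Q) : Sig X fun a => P a ∨ Q a := by
  obtain ⟨R, hR, h⟩ := hP
  obtain ⟨R', hR', h'⟩ := hQ
  refine ⟨fun p => R p ∨ R' p, hR.or hR', fun a => ?_⟩
  simp only [h, h', exists_or]

theorem Sig.const (p : Prop) : Sig X fun _ : α => p := by
  by_cases hp : p
  · exact ⟨fun _ => True, ⟨fun _ => isTrue trivial, by simpa using Primrec.const true⟩,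
      fun a => by simp [hp]⟩
  · exact ⟨fun _ => False, ⟨fun _ => isFalse id, by simpa using Primrec.const false⟩,
      fun a => by simp [hp]⟩

/-- The code of the witness is bounded by the length of the oracle segment; persistence of `R`
allows the segment to be lengthened until it exceeds that code. -/
theorem Sig.exists {P : α × β → Prop} (h : Sig X P) : Sig X fun a => ∃ b, P (a, b) := by
  obtain ⟨R, hR, h, m⟩ := h.normal
  have hd : PrimrecRel fun (k : ℕ) (p : α × List ℕ) =>
      ∃ b ∈ (Encodable.decode (α := β) k).toList, R ((p.1, b), p.2) := by
    have : PrimrecRel fun (b : β) (p : α × List ℕ) => R ((p.1, b), p.2) :=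
      hR.comp (((Primrec.fst.comp Primrec.snd).pair Primrec.fst).pair (Primrec.snd.comp Primrec.snd))
    exact this.exists_mem_list.comp (Primrec.optionToList.comp (Primrec.decode.comp Primrec.fst))
      Primrec.snd
  refine ⟨fun p => ∃ k < p.2.length,
    ∃ b ∈ (Encodable.decode (α := β) k).toList, R ((p.1, b), p.2), ?_, fun a => ?_⟩
  · exact primrec_exists_lt hd (Primrec.list_length.comp Primrec.snd)
  · constructor
    · rintro ⟨b, hb⟩
      obtain ⟨n, hn⟩ := (h _).1 hb
      refine ⟨max n (Encodable.encode b + 1), Encodable.encode b, by simp, b, by simp, ?_⟩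
      exact m _ _ _ (le_max_left _ _) hn
    · rintro ⟨n, k, _, b, _, hb⟩
      exact ⟨b, (h _).2 ⟨n, hb⟩⟩

theorem Sig.forall_mem {P : α × β → Prop} (h : Sig X P) {L : α → List β} (hL : Primrec L) :
    Sig X fun a => ∀ b ∈ L a, P (a, b) := by
  obtain ⟨R, hR, h, m⟩ := h.normal
  refine ⟨fun p => ∀ b ∈ L p.1, R ((p.1, b), p.2), ?_, fun a => ?_⟩
  · have : PrimrecRel fun (b : β) (p : α × List ℕ) => R ((p.1, b), p.2) :=
      hR.comp (((Primrec.fst.comp Primrec.snd).pair Primrec.fst).pair (Primrec.snd.comp Primrec.snd))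
    exact this.forall_mem_list.comp (hL.comp Primrec.fst) Primrec.id
  · constructor
    · intro H
      have : ∀ l : List β, (∀ b ∈ l, P (a, b)) → ∃ n, ∀ b ∈ l, R ((a, b), approx X n) := by
        intro l
        induction l with
        | nil => exact fun _ => ⟨0, by simp⟩
        | cons c l ih =>
          intro hl
          obtain ⟨n, hn⟩ := ih fun b hb => hl b (List.mem_cons_of_mem _ hb)
          obtain ⟨k, hk⟩ := (h _).1 (hl c List.mem_cons_self)
          refine ⟨max n k, fun b hb => ?_⟩
          rcases List.mem_cons.1 hb with rfl | hb
          · exact m _ _ _ (le_max_right _ _) hk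
          · exact m _ _ _ (le_max_left _ _) (hn b hb)
      exact this _ H
    · rintro ⟨n, hn⟩ b hb
      exact (h _).2 ⟨n, hn b hb⟩

theorem Sig.exists_mem {P : α × β → Prop} (h : Sig X P) {L : α → List β} (hL : Primrec L) :
    Sig X fun a => ∃ b ∈ L a, P (a, b) := by
  classical
  refine Sig.exists (P := fun p : α × β => p.2 ∈ L p.1 ∧ P p) (Sig.and (Sig.of_primrec ?_) h)
  have : PrimrecRel fun (L : List β) (b : β) => ∃ c ∈ L, c = b :=
    PrimrecRel.exists_mem_list Primrec.eq
  exact (this.comp (hL.comp Primrec.fst) Primrec.snd).of_eq fun p => by simp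

theorem Sig.forall_lt {P : α × ℕ → Prop} (h : Sig X P) {f : α → ℕ} (hf : Primrec f) :
    Sig X fun a => ∀ n < f a, P (a, n) :=
  (h.forall_mem (Primrec.list_range.comp hf)).of_iff fun a => by simp

theorem Sig.exists_finset {ι : Type} {P : ι → α → Prop} (s : Finset ι) (h : ∀ i, Sig X (P i)) :
    Sig X fun a => ∃ i ∈ s, P i a := by
  classical
  induction s using Finset.induction_on with
  | empty => simpa using Sig.const False
  | insert i s _ ih => exact ((h i).or ih).of_iff fun a => by simp

theorem Sig.exists_finite {ι : Type} [Finite ι] {P : ι → α → Prop} (h : ∀ i, Sig X (P i)) :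
    Sig X fun a => ∃ i, P i a := by
  have := Fintype.ofFinite ι
  exact (Sig.exists_finset Finset.univ h).of_iff fun a => by simp

theorem Sig.oracle : Sig X fun p : ℕ × ℕ => X p.1 = p.2 := by
  refine ⟨fun q => q.2[q.1.1]? = some q.1.2, ?_, fun a => ?_⟩
  · exact Primrec.eq.comp (Primrec.list_getElem?.comp Primrec.snd (Primrec.fst.comp Primrec.fst))
      (Primrec.option_some.comp (Primrec.snd.comp Primrec.fst))
  · constructor
    · intro h
      exact ⟨a.1 + 1, by simp [approx, h]⟩
    · rintro ⟨n, hn⟩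
      obtain ⟨h, hn⟩ := List.getElem?_eq_some_iff.1 hn
      rwa [getElem_approx] at hn

/-- `Y` is computable in `X`. -/
def Red (X Y : ℕ → ℕ) : Prop := Sig X fun p : ℕ × ℕ => Y p.1 = p.2

theorem Red.sig_approx (h : Red X Y) : Sig X fun s : List ℕ => s = approx Y s.length := by
  have h' : Sig X fun p : List ℕ × ℕ => Y p.2 = p.1.getD p.2 0 :=
    Sig.comp h (f := fun p : List ℕ × ℕ => (p.2, p.1.getD p.2 0))
      (Primrec.snd.pair ((Primrec.list_getD 0).comp Primrec.fst Primrec.snd))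
  exact (h'.forall_mem (Primrec.list_range.comp Primrec.list_length)).of_iff
    fun s => eq_approx_iff Y s 0

/-- The segment of `Y` that witnesses `P` is guessed, and the guess is verified by `X`. -/
theorem Sig.trans (h : Sig Y P) (hY : Red X Y) : Sig X P := by
  obtain ⟨R, hR, h⟩ := h
  have : Sig X fun p : α × List ℕ => R p ∧ p.2 = approx Y p.2.length :=
    (Sig.of_primrec hR).and (hY.sig_approx.comp Primrec.snd)
  refine this.exists.of_iff fun a => (h a).trans ⟨fun ⟨n, hn⟩ => ⟨_, hn, by simp⟩, ?_⟩
  rintro ⟨s, hs, hs'⟩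
  simp only at hs'
  rw [hs'] at hs
  exact ⟨_, hs⟩

theorem Red.refl (X : ℕ → ℕ) : Red X X := Sig.oracle
theorem Red.trans (h₁ : Red X Y) (h₂ : Red Y Z) : Red X Z := Sig.trans h₂ h₁

/-- The pointwise pair of two oracles. -/
def join (X Y : ℕ → ℕ) (n : ℕ) : ℕ := Nat.pair (X n) (Y n)

theorem Red.join (hX : Red Z X) (hY : Red Z Y) : Red Z (join X Y) := by
  have h₁ : Sig Z fun p : ℕ × ℕ => X p.1 = p.2.unpair.1 :=
    Sig.comp hX (f := fun p : ℕ × ℕ => (p.1, p.2.unpair.1))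
      (Primrec.fst.pair (Primrec.fst.comp (Primrec.unpair.comp Primrec.snd)))
  have h₂ : Sig Z fun p : ℕ × ℕ => Y p.1 = p.2.unpair.2 :=
    Sig.comp hY (f := fun p : ℕ × ℕ => (p.1, p.2.unpair.2))
      (Primrec.fst.pair (Primrec.snd.comp (Primrec.unpair.comp Primrec.snd)))
  refine (h₁.and h₂).of_iff fun p => ?_
  constructor
  · intro h
    simp [← h, SOA.join]
  · rintro ⟨h, h'⟩
    simp [SOA.join, h, h']

theorem red_join_left : Red (join X Y) X := by
  have h : Sig (join X Y) fun p : (ℕ × ℕ) × ℕ => join X Y p.1.1 = Nat.pair p.1.2 p.2 :=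
    Sig.oracle.comp (f := fun p : (ℕ × ℕ) × ℕ => (p.1.1, Nat.pair p.1.2 p.2))
      ((Primrec.fst.comp Primrec.fst).pair
        (Primrec₂.natPair.comp (Primrec.snd.comp Primrec.fst) Primrec.snd))
  exact h.exists.of_iff fun p => by simp [join, Nat.pair_eq_pair]

theorem red_join_right : Red (join X Y) Y := by
  have h : Sig (join X Y) fun p : (ℕ × ℕ) × ℕ => join X Y p.1.1 = Nat.pair p.2 p.1.2 :=
    Sig.oracle.comp (f := fun p : (ℕ × ℕ) × ℕ => (p.1.1, Nat.pair p.2 p.1.2))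
      ((Primrec.fst.comp Primrec.fst).pair
        (Primrec₂.natPair.comp Primrec.snd (Primrec.snd.comp Primrec.fst)))
  exact h.exists.of_iff fun p => by simp [join, Nat.pair_eq_pair]

/-- The set `B` is computable in `X`. -/
def Rec (X : ℕ → ℕ) (B : Set ℕ) : Prop := Sig X (· ∈ B) ∧ Sig X (· ∉ B)

open Classical in
/-- The characteristic function of a set. -/
noncomputable def chi (B : Set ℕ) (n : ℕ) : ℕ := if n ∈ B then 1 else 0

theorem Rec.trans {B : Set ℕ} (h : Rec Y B) (hY : Red X Y) : Rec X B :=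
  ⟨h.1.trans hY, h.2.trans hY⟩

theorem Rec.compl {B : Set ℕ} (h : Rec X B) : Rec X Bᶜ :=
  ⟨h.2, h.1.of_iff fun a => by simp⟩

theorem Rec.inter {B C : Set ℕ} (h : Rec X B) (h' : Rec X C) : Rec X (B ∩ C) :=
  ⟨h.1.and h'.1, (h.2.or h'.2).of_iff fun a => by simp only [Set.mem_inter_iff]; tauto⟩

theorem Rec.diff {B C : Set ℕ} (h : Rec X B) (h' : Rec X C) : Rec X (B \ C) :=
  h.inter h'.compl

theorem Rec.red {B : Set ℕ} (h : Rec X B) : Red X (chi B) := by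
  have h₁ : Sig X fun p : ℕ × ℕ => p.2 = 1 ∧ p.1 ∈ B :=
    (Sig.of_primrec (Primrec.eq.comp Primrec.snd (Primrec.const 1))).and (h.1.comp Primrec.fst)
  have h₂ : Sig X fun p : ℕ × ℕ => p.2 = 0 ∧ p.1 ∉ B :=
    (Sig.of_primrec (Primrec.eq.comp Primrec.snd (Primrec.const 0))).and (h.2.comp Primrec.fst)
  refine (h₁.or h₂).of_iff fun p => ?_
  by_cases hp : p.1 ∈ B <;> simp [chi, hp, eq_comm]

theorem rec_of_red {B : Set ℕ} (h : Red X (chi B)) : Rec X B := by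
  refine ⟨(Sig.comp h (f := fun n => (n, 1)) (Primrec.id.pair (Primrec.const 1))).of_iff ?_,
    (Sig.comp h (f := fun n => (n, 0)) (Primrec.id.pair (Primrec.const 0))).of_iff ?_⟩ <;>
  · intro a
    by_cases ha : a ∈ B <;> simp [chi, ha]

theorem Rec.of_primrec {B : Set ℕ} (h : PrimrecPred (· ∈ B)) : Rec X B :=
  ⟨Sig.of_primrec h, Sig.of_primrec h.not⟩

theorem Rec.of_finite {B : Set ℕ} (h : B.Finite) : Rec X B := by
  refine Rec.of_primrec ?_
  have : PrimrecRel fun (L : List ℕ) (b : ℕ) => ∃ c ∈ L, c = b :=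
    PrimrecRel.exists_mem_list Primrec.eq
  exact (this.comp (Primrec.const h.toFinset.toList) Primrec.id).of_eq fun p => by simp

/-- A total relation that is recursively enumerable in `X` contains the graph of a function
computable in `X`. -/
theorem Sig.uniformize {R : ℕ × Bool → Prop} (h : Sig X R) (tot : ∀ a, ∃ b, R (a, b)) :
    ∃ f : ℕ → Bool, Sig X (fun p : ℕ × Bool => f p.1 = p.2) ∧ ∀ a, R (a, f a) := by
  classical
  obtain ⟨S, hS, h⟩ := h
  have ex : ∀ a, ∃ n, ∃ b, S ((a, b), approx X n) := fun a => by
    obtain ⟨b, hb⟩ := tot a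
    obtain ⟨n, hn⟩ := (h _).1 hb
    exact ⟨n, b, hn⟩
  -- The value is read off at the least length at which some bit is witnessed, with `true` preferred
  -- in case of a tie.
  let f : ℕ → Bool := fun a => decide (S ((a, true), approx X (Nat.find (ex a))))
  have hf : ∀ a, S ((a, f a), approx X (Nat.find (ex a))) := by
    intro a
    by_cases ht : S ((a, true), approx X (Nat.find (ex a)))
    · have : f a = true := decide_eq_true ht
      rwa [this]
    · obtain ⟨b, hb⟩ := Nat.find_spec (ex a)
      cases b
      · have : f a = false := decide_eq_false ht
        rwa [this]
      · exact absurd hb ht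
  refine ⟨f, ?_, fun a => (h _).2 ⟨_, hf a⟩⟩
  have hSt : PrimrecRel fun (a : ℕ) (s : List ℕ) => S ((a, true), s) :=
    hS.comp ((Primrec.fst.pair (Primrec.const true)).pair Primrec.snd)
  have hSf : PrimrecRel fun (a : ℕ) (s : List ℕ) => S ((a, false), s) :=
    hS.comp ((Primrec.fst.pair (Primrec.const false)).pair Primrec.snd)
  have hlt : PrimrecRel fun (k : ℕ) (p : ℕ × List ℕ) =>
      ¬(S ((p.1, true), p.2.take k) ∨ S ((p.1, false), p.2.take k)) := by
    have h₁ : Primrec fun q : ℕ × ℕ × List ℕ => q.2.1 := Primrec.fst.comp Primrec.snd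
    have h₂ : Primrec fun q : ℕ × ℕ × List ℕ => q.2.2.take q.1 :=
      Primrec.list_take.comp Primrec.fst (Primrec.snd.comp Primrec.snd)
    exact ((hSt.comp h₁ h₂).or (hSf.comp h₁ h₂)).not
  -- The segment is required to be the first one that decides, so the least length is recovered from
  -- the witness.
  refine ⟨fun q => (∀ k < q.2.length, ¬(S ((q.1.1, true), q.2.take k) ∨
      S ((q.1.1, false), q.2.take k))) ∧
      (S ((q.1.1, true), q.2) ∧ q.1.2 = true ∨
        ¬S ((q.1.1, true), q.2) ∧ S ((q.1.1, false), q.2) ∧ q.1.2 = false), ?_, fun a => ?_⟩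
  · have h₁ : Primrec fun q : (ℕ × Bool) × List ℕ => q.1.1 := Primrec.fst.comp Primrec.fst
    have h₂ : Primrec fun q : (ℕ × Bool) × List ℕ => q.1.2 := Primrec.snd.comp Primrec.fst
    have h₃ : Primrec fun q : (ℕ × Bool) × List ℕ => q.2 := Primrec.snd
    have hlt' : PrimrecRel fun (k : ℕ) (q : (ℕ × Bool) × List ℕ) =>
        ¬(S ((q.1.1, true), q.2.take k) ∨ S ((q.1.1, false), q.2.take k)) :=
      hlt.comp Primrec.fst ((h₁.pair h₃).comp Primrec.snd)
    refine (primrec_forall_lt hlt' (Primrec.list_length.comp h₃)).and ?_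
    exact ((hSt.comp h₁ h₃).and (Primrec.eq.comp h₂ (Primrec.const true))).or
      ((hSt.comp h₁ h₃).not.and ((hSf.comp h₁ h₃).and (Primrec.eq.comp h₂ (Primrec.const false))))
  · obtain ⟨a, b⟩ := a
    simp only
    constructor
    · rintro rfl
      refine ⟨Nat.find (ex a), fun k hk => ?_, ?_⟩
      · simp only [length_approx] at hk
        rw [take_approx X hk.le]
        have := Nat.find_min (ex a) hk
        rintro (h | h)
        exacts [this ⟨_, h⟩, this ⟨_, h⟩]
      · have := hf a
        by_cases ht : S ((a, true), approx X (Nat.find (ex a)))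
        · left; exact ⟨ht, decide_eq_true ht⟩
        · right
          have hfa : f a = false := decide_eq_false ht
          rw [hfa] at this
          exact ⟨ht, this, hfa⟩
    · rintro ⟨n, hn, hn'⟩
      have : Nat.find (ex a) = n := by
        rw [Nat.find_eq_iff]
        refine ⟨?_, fun k hk => ?_⟩
        · rcases hn' with ⟨h, _⟩ | ⟨_, h, _⟩
          exacts [⟨_, h⟩, ⟨_, h⟩]
        · have := hn k (by simpa using hk)
          rw [take_approx X hk.le] at this
          rintro ⟨_ | _, hb⟩
          exacts [this (Or.inr hb), this (Or.inl hb)]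
      simp only [f, this]
      rcases hn' with ⟨h, hb⟩ | ⟨h, _, hb⟩ <;> simp_all

end Sigma

/-! ### Compactness of the space of sequences over a finite alphabet. -/

section Compactness

variable {α β : Type} [Primcodable α] [Primcodable β] {X : ℕ → ℕ}

theorem isOpen_approx {β : Type} [TopologicalSpace β] [DiscreteTopology β]
    (p : List β → Prop) (n : ℕ) : IsOpen {Y : ℕ → β | p (approx Y n)} := by
  rw [isOpen_iff_forall_mem_open]
  intro Y hY
  refine ⟨(↑(Finset.range n) : Set ℕ).pi fun i => {Y i}, fun Y' hY' => ?_,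
    isOpen_set_pi (Finset.finite_toSet _) fun i _ => isOpen_discrete _, fun i _ => rfl⟩
  have : approx Y' n = approx Y n := approx_congr fun i hi => hY' i (by simpa using hi)
  change p _
  rw [this]
  exact hY

/-- The fan theorem: the open sets of sequences barred by length `N` increase with `N` and cover a
compact space. -/
theorem bar_bounded {β : Type} [Finite β] {p : List β → Prop}
    (h : ∀ Y : ℕ → β, ∃ n, p (approx Y n)) : ∃ N, ∀ Y : ℕ → β, ∃ n ≤ N, p (approx Y n) := by
  let _ : TopologicalSpace β := ⊥
  have : DiscreteTopology β := ⟨rfl⟩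
  obtain ⟨N, hN⟩ := isCompact_univ.elim_directed_cover
    (fun N => ⋃ n ∈ Finset.range (N + 1), {Y : ℕ → β | p (approx Y n)})
    (fun N => isOpen_biUnion fun n _ => isOpen_approx p n)
    (fun Y _ => by
      obtain ⟨n, hn⟩ := h Y
      exact Set.mem_iUnion.2 ⟨n, Set.mem_iUnion₂.2 ⟨n, by simp, hn⟩⟩)
    (directed_of_isDirected_le fun M N hMN => Set.biUnion_mono
      (fun n hn => by simp at hn ⊢; omega) fun _ _ => subset_rfl)
  refine ⟨N, fun Y => ?_⟩
  obtain ⟨n, hn, hY⟩ := Set.mem_iUnion₂.1 (hN (Set.mem_univ Y))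
  exact ⟨n, by simp at hn; omega, hY⟩

/-- All words of length `n` over the alphabet `L`. -/
def words {β : Type} (L : List β) (n : ℕ) : List (List β) :=
  Nat.rec [[]] (fun _ W => W.flatMap fun w => L.map fun b => w ++ [b]) n

theorem primrec_words (L : List β) : Primrec (words L) := by
  refine Primrec.nat_rec₁ _ ?_
  refine Primrec.list_flatMap Primrec.snd ?_
  refine Primrec.list_map (Primrec.const L) ?_
  exact Primrec.list_concat.comp (Primrec.snd.comp Primrec.fst) Primrec.snd

theorem approx_succ {α : Type} (Y : ℕ → α) (n : ℕ) : approx Y (n + 1) = approx Y n ++ [Y n] := by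
  simp [approx, List.range_succ]

theorem approx_mem_words {β : Type} {L : List β} (hL : ∀ b, b ∈ L) (Y : ℕ → β) (n : ℕ) :
    approx Y n ∈ words L n := by
  induction n with
  | zero => simp [words, approx]
  | succ n ih =>
    rw [approx_succ]
    exact List.mem_flatMap.2 ⟨_, ih, List.mem_map.2 ⟨_, hL _, rfl⟩⟩

theorem length_of_mem_words {β : Type} {L : List β} {n : ℕ} {s : List β} (h : s ∈ words L n) :
    s.length = n := by
  induction n generalizing s with
  | zero => simp [words] at h; simp [h]
  | succ n ih =>
    obtain ⟨w, hw, h⟩ := List.mem_flatMap.1 h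
    obtain ⟨b, -, rfl⟩ := List.mem_map.1 h
    simp [ih hw]

theorem exists_eq_approx {β : Type} [Nonempty β] (s : List β) :
    ∃ Y : ℕ → β, s = approx Y s.length := by
  obtain ⟨d⟩ := ‹Nonempty β›
  exact ⟨fun i => s.getD i d, (eq_approx_iff _ s d).2 fun _ _ => rfl⟩

/-- Quantification over a compact space of sequences preserves recursive enumerability. -/
theorem Sig.forall_seq [Finite β] [Nonempty β] {V : α × List β → Prop} (h : Sig X V) :
    Sig X fun a => ∀ Y : ℕ → β, ∃ n, V (a, approx Y n) := by
  have := Fintype.ofFinite β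
  let L : List β := Finset.univ.toList
  have hL : ∀ b, b ∈ L := fun b => by simp [L]
  have h₁ : Sig X fun q : ((α × ℕ) × List β) × ℕ => V (q.1.1.1, q.1.2.take q.2) :=
    h.comp (f := fun q : ((α × ℕ) × List β) × ℕ => (q.1.1.1, q.1.2.take q.2))
      ((Primrec.fst.comp (Primrec.fst.comp Primrec.fst)).pair
        (Primrec.list_take.comp Primrec.snd (Primrec.snd.comp Primrec.fst)))
  have h₂ := h₁.exists_mem (L := fun q : (α × ℕ) × List β => List.range (q.1.2 + 1))
    (Primrec.list_range.comp (Primrec.succ.comp (Primrec.snd.comp Primrec.fst)))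
  have h₃ := h₂.forall_mem (L := fun q : α × ℕ => words L q.2) ((primrec_words L).comp Primrec.snd)
  -- A bounded bar replaces the quantifier over sequences by one over the finitely many words of
  -- length `N`.
  refine h₃.exists.of_iff fun a => ?_
  simp only [List.mem_range, Nat.lt_succ_iff]
  constructor
  · intro H
    obtain ⟨N, hN⟩ := bar_bounded (p := fun s => V (a, s)) H
    refine ⟨N, fun s hs => ?_⟩
    have hl := length_of_mem_words hs
    obtain ⟨Y, hY⟩ := exists_eq_approx s
    obtain ⟨n, hn, hV⟩ := hN Y
    refine ⟨n, hn, ?_⟩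
    rwa [hY, take_approx Y (by omega)]
  · rintro ⟨N, hN⟩ Y
    obtain ⟨n, hn, hV⟩ := hN _ (approx_mem_words hL Y N)
    rw [take_approx Y hn] at hV
    exact ⟨n, hV⟩

end Compactness

end SOA

/-! ### A recursively inseparable pair, and functionals with a set oracle -/

namespace SOA

/-- The diagonal computation with input `n` halts within `t` steps with output `b`. -/
def diagStage (t n : ℕ) (b : Bool) : Prop :=
  b.toNat ∈ Nat.Partrec.Code.evaln t (Denumerable.ofNat Nat.Partrec.Code n) n

/-- The diagonal computation with input `n` halts with output `b`. -/
def Diag (n : ℕ) (b : Bool) : Prop := ∃ t, diagStage t n b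

theorem primrec_toNat : Primrec Bool.toNat := Primrec.dom_bool _

theorem primrec_diagStage :
    PrimrecPred fun p : ℕ × ℕ × Bool => diagStage p.1 p.2.1 p.2.2 := by
  have h₁ : Primrec fun p : ℕ × ℕ × Bool => p.2.1 := Primrec.fst.comp Primrec.snd
  have h : Primrec fun p : ℕ × ℕ × Bool =>
      Nat.Partrec.Code.evaln p.1 (Denumerable.ofNat Nat.Partrec.Code p.2.1) p.2.1 :=
    Nat.Partrec.Code.primrec_evaln.comp
      ((Primrec.fst.pair ((Primrec.ofNat Nat.Partrec.Code).comp h₁)).pair h₁)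
  exact (Primrec.eq.comp h (Primrec.option_some.comp
    (primrec_toNat.comp (Primrec.snd.comp Primrec.snd)))).of_eq fun p => Iff.rfl

theorem Diag.unique {n : ℕ} {b c : Bool} (hb : Diag n b) (hc : Diag n c) : b = c := by
  obtain ⟨t, ht⟩ := hb
  obtain ⟨t', ht'⟩ := hc
  have h := Part.mem_unique (Nat.Partrec.Code.evaln_sound ht) (Nat.Partrec.Code.evaln_sound ht')
  cases b <;> cases c <;> simp_all

theorem sig_diag (X : ℕ → ℕ) : Sig X fun p : ℕ × Bool => Diag p.1 p.2 := by
  have h : Sig X fun q : (ℕ × Bool) × ℕ => diagStage q.2 q.1.1 q.1.2 :=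
    (Sig.of_primrec primrec_diagStage).comp (f := fun q : (ℕ × Bool) × ℕ => (q.2, q.1))
      (Primrec.snd.pair Primrec.fst)
  exact h.exists

/-- No function computable in `X` avoids the partial diagonal function everywhere. -/
def NonSep (X : ℕ → ℕ) : Prop :=
  ¬∃ h : ℕ → Bool, Sig X (fun p : ℕ × Bool => h p.1 = p.2) ∧ ∀ n, ¬Diag n (h n)

theorem NonSep.of_red {X Y : ℕ → ℕ} (hX : NonSep X) (h : Red X Y) : NonSep Y :=
  fun ⟨f, hf, hd⟩ => hX ⟨f, hf.trans h, hd⟩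

/-- Diagonalisation: a separation computable in the zero oracle is recursive. If `c` is a code for
it, then on input `c` the diagonal computation halts with exactly the value of the separation at
`c`. -/
theorem nonSep_zero : NonSep fun _ => 0 := by
  classical
  rintro ⟨h, ⟨R, hR, hh⟩, hd⟩
  -- The number `z` packs a candidate value, its lowest bit, and an oracle length, so one unbounded
  -- search finds both.
  let p : ℕ → ℕ → Bool := fun a z => decide (R ((a, z.bodd), approx (fun _ => 0) z.div2))
  have hp : Primrec₂ p := by
    refine PrimrecPred.decide (hR.comp ?_)
    refine (Primrec.fst.pair (Primrec.nat_bodd.comp Primrec.snd)).pair ?_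
    exact Primrec.list_map (Primrec.list_range.comp (Primrec.nat_div2.comp Primrec.snd))
      (Primrec₂.const 0)
  let f : ℕ →. ℕ := fun a => (Nat.rfind fun z => Part.some (p a z)).map fun z => z.bodd.toNat
  have hf : Partrec f := by
    refine Partrec.map (Partrec.rfind hp.to_comp.partrec₂) ?_
    exact ((primrec_toNat.comp Primrec.nat_bodd).comp Primrec.snd).to_comp
  obtain ⟨c, hc⟩ := Nat.Partrec.Code.exists_code.1 (Partrec.nat_iff.1 hf)
  have hm : ∀ a, (h a).toNat ∈ f a := by
    intro a
    obtain ⟨n, hn⟩ := (hh (a, h a)).1 rfl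
    have hpz : p a (Nat.bit (h a) n) = true := by
      simp only [p, Nat.bodd_bit, Nat.div2_bit]
      exact decide_eq_true hn
    obtain ⟨z, hz, -⟩ := Nat.rfind_min' (p := p a) hpz
    have hz' : p a z = true := by simpa using (Nat.rfind_spec hz)
    have : R ((a, z.bodd), approx (fun _ => 0) z.div2) := of_decide_eq_true hz'
    have hb : h a = z.bodd := (hh (a, z.bodd)).2 ⟨_, this⟩
    rw [hb]
    exact Part.mem_map _ hz
  have := hm (Encodable.encode c)
  rw [← hc, Nat.Partrec.Code.evaln_complete] at this
  obtain ⟨t, ht⟩ := this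
  exact hd (Encodable.encode c) ⟨t, by simpa [diagStage] using ht⟩

/-- A finite list of guesses is correct if every guessed value differs from a diagonal value that
exists. -/
def Correct (v : List (ℕ × Bool)) : Prop := ∀ p ∈ v, Diag p.1 !p.2

theorem sig_correct (X : ℕ → ℕ) : Sig X Correct := by
  have h : Sig X fun q : List (ℕ × Bool) × ℕ × Bool => Diag q.2.1 !q.2.2 :=
    (sig_diag X).comp (f := fun q : List (ℕ × Bool) × ℕ × Bool => (q.2.1, !q.2.2))
      ((Primrec.fst.comp Primrec.snd).pair (Primrec.not.comp (Primrec.snd.comp Primrec.snd)))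
  exact h.forall_mem Primrec.id

/-- A recursively enumerable set of lists of guesses that contains no correct one omits all guesses
on some tuple of places. -/
theorem exists_tuple_avoiding {X : ℕ → ℕ} (hX : NonSep X) (N : ℕ) :
    ∀ W : List (ℕ × Bool) → Prop, Sig X W → (∀ v, W v → ¬Correct v) →
      ∃ a : List ℕ, a.length = N ∧ ∀ b : List Bool, b.length = N → ¬W (a.zip b) := by
  induction N with
  | zero =>
    intro W _ hc
    exact ⟨[], rfl, fun b _ h => hc _ h (by simp [Correct])⟩
  | succ N ih =>
    intro W hW hc
    -- If a suitable `b₀` exists for every `a₀`, an enumeration finds one, and the flipped bit `!b₀`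
    -- avoids the diagonal: otherwise `(a₀, b₀) :: v` would be a correct member of `W`.
    by_cases hB : ∀ a₀, ∃ b₀ v, Correct v ∧ W ((a₀, b₀) :: v)
    · exfalso
      have hcons : Primrec fun q : (ℕ × Bool) × List (ℕ × Bool) => (q.1.1, !q.1.2) :: q.2 :=
        Primrec.list_cons.comp ((Primrec.fst.comp Primrec.fst).pair
          (Primrec.not.comp (Primrec.snd.comp Primrec.fst))) Primrec.snd
      have hS : Sig X fun q : (ℕ × Bool) × List (ℕ × Bool) =>
          Correct q.2 ∧ W ((q.1.1, !q.1.2) :: q.2) :=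
        ((sig_correct X).comp Primrec.snd).and (hW.comp hcons)
      obtain ⟨f, hf, hf'⟩ := hS.exists.uniformize fun a => by
        obtain ⟨b, v, h, h'⟩ := hB a
        exact ⟨!b, v, h, by simpa using h'⟩
      refine hX ⟨f, hf, fun n hn => ?_⟩
      obtain ⟨v, hv, hv'⟩ := hf' n
      refine hc _ hv' fun p hp => ?_
      rcases List.mem_cons.1 hp with rfl | hp
      · simpa using hn
      · exact hv p hp
    -- At the remaining place `a₀`, neither bit is completed to a member of `W` by a correct list,
    -- so the tails of members beginning at `a₀` again include no correct list.
    · push Not at hB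
      obtain ⟨a₀, ha₀⟩ := hB
      have hcons : Primrec fun q : List (ℕ × Bool) × Bool => (a₀, q.2) :: q.1 :=
        Primrec.list_cons.comp ((Primrec.const a₀).pair Primrec.snd) Primrec.fst
      obtain ⟨a, ha, ha'⟩ := ih (fun v => ∃ b₀, W ((a₀, b₀) :: v))
        (Sig.exists (P := fun q : List (ℕ × Bool) × Bool => W ((a₀, q.2) :: q.1)) (hW.comp hcons))
        (fun v ⟨b, hb⟩ hv => ha₀ b v hv hb)
      refine ⟨a₀ :: a, by simp [ha], fun b hb => ?_⟩
      cases b with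
      | nil => simp at hb
      | cons b₀ b => exact fun h => ha' b (by simpa using hb) ⟨b₀, h⟩

/-- A primitive recursive function is determined by a code. Countability of the functionals lets a
single sequence of conditions meet all requirements. -/
theorem countable_primrec {α β : Type} [Primcodable α] [Primcodable β] :
    Countable {f : α → β // Primrec f} := by
  have h₁ : Countable {F : ℕ → ℕ // Nat.Primrec F} := by
    have : ∀ F : {F : ℕ → ℕ // Nat.Primrec F}, ∃ c : Nat.Partrec.Code, c.eval = (F.1 : ℕ →. ℕ) :=
      fun F => Nat.Partrec.Code.exists_code.1 (Nat.Partrec.of_primrec F.2)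
    choose c hc using this
    refine Function.Injective.countable (f := c) fun F G h => ?_
    have := (hc F).symm.trans ((congrArg Nat.Partrec.Code.eval h).trans (hc G))
    refine Subtype.ext (funext fun n => ?_)
    exact Part.some_injective (congrFun this n)
  refine Function.Injective.countable (β := {F : ℕ → ℕ // Nat.Primrec F})
    (f := fun f => ⟨fun n => Encodable.encode ((Encodable.decode n).map f.1), f.2⟩) fun f g h => ?_
  refine Subtype.ext (funext fun a => ?_)
  have := congrFun (congrArg Subtype.val h) (Encodable.encode a)
  simpa using this

theorem countable_primrecPred {α : Type} [Primcodable α] :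
    Countable {p : α → Prop // PrimrecPred p} := by
  classical
  have := countable_primrec (α := α) (β := Bool)
  refine Function.Injective.countable (β := {f : α → Bool // Primrec f})
    (f := fun R => ⟨fun p => decide (R.1 p), R.2.decide⟩) fun R S h => ?_
  refine Subtype.ext (funext fun p => ?_)
  have := congrFun (congrArg Subtype.val h) p
  simpa using this

/-- Codes of functionals: primitive recursive relations between inputs and oracle segments. -/
abbrev Functional : Type := {R : (ℕ × Bool) × List ℕ → Prop // PrimrecPred R}

instance : Countable Functional := countable_primrecPred

/-- The sequence of bits of a finite string, padded by zeros. -/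
def bits (τ : List Bool) (n : ℕ) : ℕ := (τ.getD n false).toNat

/-- The functional `r` with oracles `X` and the finite string `τ` returns `b` at `n`. -/
def Psi (X : ℕ → ℕ) (r : Functional) (τ : List Bool) (n : ℕ) (b : Bool) : Prop :=
  ∃ s : List ℕ, r.1 ((n, b), s) ∧ s.length ≤ τ.length ∧ s = approx (join X (bits τ)) s.length

theorem sig_psi (X : ℕ → ℕ) (r : Functional) :
    Sig X fun p : List Bool × ℕ × Bool => Psi X r p.1 p.2.1 p.2.2 := by
  have e₁ : Primrec fun q : ((List Bool × ℕ × Bool) × List ℕ) × ℕ => q.1.2.getD q.2 0 :=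
    (Primrec.list_getD 0).comp (Primrec.snd.comp Primrec.fst) Primrec.snd
  have e₂ : Primrec fun q : ((List Bool × ℕ × Bool) × List ℕ) × ℕ => bits q.1.1.1 q.2 :=
    primrec_toNat.comp ((Primrec.list_getD false).comp
      (Primrec.fst.comp (Primrec.fst.comp Primrec.fst)) Primrec.snd)
  have h₁ : Sig X fun q : (((List Bool × ℕ × Bool) × List ℕ) × ℕ) × ℕ => X q.1.2 = q.2 :=
    Sig.oracle.comp (f := fun q : (((List Bool × ℕ × Bool) × List ℕ) × ℕ) × ℕ => (q.1.2, q.2))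
      ((Primrec.snd.comp Primrec.fst).pair Primrec.snd)
  have h₂ : Sig X fun q : (((List Bool × ℕ × Bool) × List ℕ) × ℕ) × ℕ =>
      Nat.pair q.2 (bits q.1.1.1.1 q.1.2) = q.1.1.2.getD q.1.2 0 :=
    Sig.of_primrec (Primrec.eq.comp (Primrec₂.natPair.comp Primrec.snd (e₂.comp Primrec.fst))
      (e₁.comp Primrec.fst))
  have h₃ := (h₁.and h₂).exists.forall_mem (α := (List Bool × ℕ × Bool) × List ℕ)
    (L := fun q => List.range q.2.length)
    (Primrec.list_range.comp (Primrec.list_length.comp Primrec.snd))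
  have h₄ : Sig X fun q : (List Bool × ℕ × Bool) × List ℕ =>
      r.1 (q.1.2, q.2) ∧ q.2.length ≤ q.1.1.length :=
    Sig.of_primrec ((r.2.comp ((Primrec.snd.comp Primrec.fst).pair Primrec.snd)).and
      (Primrec.nat_le.comp (Primrec.list_length.comp Primrec.snd)
        (Primrec.list_length.comp (Primrec.fst.comp Primrec.fst))))
  refine (h₄.and h₃).exists.of_iff fun p => exists_congr fun s => ?_
  rw [and_assoc]
  refine and_congr_right fun _ => and_congr_right fun _ => ?_
  rw [eq_approx_iff _ _ 0]
  simp [join]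

theorem Psi.mono {X : ℕ → ℕ} {r : Functional} {σ τ : List Bool} {n : ℕ} {b : Bool}
    (h : Psi X r σ n b) (hστ : σ <+: τ) : Psi X r τ n b := by
  obtain ⟨s, h₁, h₂, h₃⟩ := h
  refine ⟨s, h₁, h₂.trans hστ.length_le, h₃.trans (approx_congr fun i hi => ?_)⟩
  obtain ⟨ρ, rfl⟩ := hστ
  simp only [join, bits, List.getD_append _ _ _ _ (lt_of_lt_of_le hi h₂)]

open Classical in
/-- The first `m` bits of a set. -/
noncomputable def initSeg (G : Set ℕ) (m : ℕ) : List Bool := approx (fun x => decide (x ∈ G)) m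

/-- Every function computable in `X` and `G` is given by a functional. -/
theorem exists_functional {X : ℕ → ℕ} {G : Set ℕ} {h : ℕ → Bool}
    (hh : Sig (join X (chi G)) fun p : ℕ × Bool => h p.1 = p.2) :
    ∃ r : Functional, ∀ n b, h n = b ↔ ∃ m, Psi X r (initSeg G m) n b := by
  obtain ⟨R, hR, hh⟩ := hh
  have key : ∀ m, ∀ k ≤ m, approx (join X (bits (initSeg G m))) k = approx (join X (chi G)) k := by
    intro m k hk
    refine approx_congr fun i hi => ?_
    simp only [join, bits, initSeg]
    rw [getD_approx _ (by omega)]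
    by_cases h : i ∈ G <;> simp [chi, h]
  refine ⟨⟨R, hR⟩, fun n b => (hh (n, b)).trans ⟨fun ⟨m, hm⟩ => ⟨m, _, hm, by simp [initSeg], ?_⟩, ?_⟩⟩
  · simp only [length_approx]
    exact (key m m le_rfl).symm
  · rintro ⟨m, s, hs, hl, hs'⟩
    rw [key m _ (by simpa [initSeg] using hl)] at hs'
    refine ⟨s.length, ?_⟩
    rw [← hs']
    exact hs

theorem lt_length_of_getD {τ : List Bool} {x : ℕ} (h : τ.getD x false = true) : x < τ.length := by
  by_contra hl
  rw [List.getD_eq_default _ _ (not_lt.1 hl)] at h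
  exact Bool.false_ne_true h

/-- The string `τ` extends `σ`, and all its new elements belong to `D`. -/
def Ext (σ τ : List Bool) (D : Set ℕ) : Prop :=
  σ <+: τ ∧ ∀ x, σ.length ≤ x → τ.getD x false = true → x ∈ D

theorem Ext.refl (σ : List Bool) (D : Set ℕ) : Ext σ σ D :=
  ⟨List.prefix_rfl, fun _ hx h => absurd (lt_length_of_getD h) hx.not_gt⟩

theorem getD_of_prefix {σ τ : List Bool} (h : σ <+: τ) {x : ℕ} (hx : x < σ.length) :
    τ.getD x false = σ.getD x false := by
  obtain ⟨ρ, rfl⟩ := h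
  exact List.getD_append _ _ _ _ hx

theorem getD_true_of_prefix {σ τ : List Bool} (h : σ <+: τ) {x : ℕ}
    (hx : σ.getD x false = true) : τ.getD x false = true := by
  rw [getD_of_prefix h (lt_length_of_getD hx), hx]

theorem Ext.mono {σ τ : List Bool} {D E : Set ℕ} (h : Ext σ τ D) (hDE : D ⊆ E) : Ext σ τ E :=
  ⟨h.1, fun x hx ht => hDE (h.2 x hx ht)⟩

theorem Ext.trans {σ τ ρ : List Bool} {D E : Set ℕ} (h : Ext σ τ D) (h' : Ext τ ρ E) (hED : E ⊆ D) :
    Ext σ ρ D := by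
  refine ⟨h.1.trans h'.1, fun x hx ht => ?_⟩
  rcases lt_or_ge x τ.length with hl | hl
  · exact h.2 x hx (by rwa [getD_of_prefix h'.1 hl] at ht)
  · exact hED (h'.2 x hl ht)

/-- Adding one new element to a string. -/
theorem exists_ext (σ : List Bool) {x : ℕ} (hx : σ.length ≤ x) :
    ∃ τ : List Bool, τ.length = x + 1 ∧ Ext σ τ {x} ∧ τ.getD x false = true := by
  have hl : (σ ++ List.replicate (x - σ.length) false).length = x := by simp; omega
  refine ⟨σ ++ List.replicate (x - σ.length) false ++ [true], by simp; omega,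
    ⟨by simp [List.append_assoc], fun y hy ht => ?_⟩, ?_⟩
  · rw [Set.mem_singleton_iff]
    by_contra hne
    rcases lt_or_gt_of_ne hne with h | h
    · rw [List.getD_append _ _ _ _ (by omega), List.getD_append_right _ _ _ _ hy] at ht
      simp [List.getD_eq_getElem?_getD, List.getElem?_replicate] at ht
      split_ifs at ht <;> simp at ht
    · rw [List.getD_eq_default _ _ (by simp; omega)] at ht
      simp at ht
  · rw [List.getD_append_right _ _ _ _ (by omega), hl]
    simp

/-- Past the end of a string its bits read as `false`, so only places below its length have to be
checked; this needs only an enumeration of `D`. -/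
theorem sig_ext {X : ℕ → ℕ} {α : Type} [Primcodable α] (σ : List Bool) {D : α → Set ℕ}
    (hD : Sig X fun p : α × ℕ => p.2 ∈ D p.1) :
    Sig X fun p : α × List Bool => Ext σ p.2 (D p.1) := by
  have h₁ : Sig X fun p : α × List Bool => σ = p.2.take σ.length :=
    Sig.of_primrec (Primrec.eq.comp (Primrec.const σ)
      (Primrec.list_take.comp (Primrec.const _) Primrec.snd))
  have h₂ : Sig X fun q : (α × List Bool) × ℕ =>
      (q.2 < σ.length ∨ q.1.2.getD q.2 false = false) ∨ q.2 ∈ D q.1.1 := by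
    refine Sig.or (Sig.of_primrec ((Primrec.nat_lt.comp Primrec.snd (Primrec.const _)).or
      (Primrec.eq.comp ((Primrec.list_getD false).comp (Primrec.snd.comp Primrec.fst) Primrec.snd)
        (Primrec.const false)))) ?_
    exact hD.comp (f := fun q : (α × List Bool) × ℕ => (q.1.1, q.2))
      ((Primrec.fst.comp Primrec.fst).pair Primrec.snd)
  refine (h₁.and (h₂.forall_lt (f := fun p => p.2.length)
    (Primrec.list_length.comp Primrec.snd))).of_iff fun p => ?_
  rw [← List.prefix_iff_eq_take]
  refine and_congr_right fun _ => forall_congr' fun x => ?_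
  constructor
  · intro h hx
    by_cases hxσ : x < σ.length
    · exact Or.inl (Or.inl hxσ)
    · cases ht : p.2.getD x false
      · exact Or.inl (Or.inr rfl)
      · exact Or.inr (h (by omega) ht)
  · intro h hx ht
    rcases h (lt_length_of_getD ht) with (h | h) | h
    · exact absurd h hx.not_gt
    · exact absurd (h.symm.trans ht) Bool.false_ne_true
    · exact h

theorem sig_mem_const {X : ℕ → ℕ} {α : Type} [Primcodable α] {E : Set ℕ} (hE : Rec X E) :
    Sig X fun p : α × ℕ => p.2 ∈ E := hE.1.comp Primrec.snd

/-- The set approximated by an increasing sequence of strings. -/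
def limitSet (σ : ℕ → List Bool) : Set ℕ := {x | ∃ s, (σ s).getD x false = true}

theorem prefix_of_le {σ : ℕ → List Bool} (h : ∀ s, σ s <+: σ (s + 1)) {s t : ℕ} (hst : s ≤ t) :
    σ s <+: σ t := by
  induction t, hst using Nat.le_induction with
  | base => exact List.prefix_rfl
  | succ t _ ih => exact ih.trans (h t)

theorem mem_limitSet_iff {σ : ℕ → List Bool} (h : ∀ s, σ s <+: σ (s + 1)) {s x : ℕ}
    (hx : x < (σ s).length) : x ∈ limitSet σ ↔ (σ s).getD x false = true := by
  refine ⟨fun ⟨t, ht⟩ => ?_, fun hs => ⟨s, hs⟩⟩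
  rcases le_total s t with hst | hst
  · rwa [getD_of_prefix (prefix_of_le h hst) hx] at ht
  · exact getD_true_of_prefix (prefix_of_le h hst) ht

theorem initSeg_prefix {σ : ℕ → List Bool} (h : ∀ s, σ s <+: σ (s + 1)) {s m : ℕ}
    (hm : m ≤ (σ s).length) : initSeg (limitSet σ) m <+: σ s := by
  classical
  rw [List.prefix_iff_eq_take]
  apply List.ext_getElem (by simp [initSeg, hm])
  intro i h₁ h₂
  have hi : i < m := by simpa [initSeg] using h₁
  simp only [initSeg, getElem_approx, List.getElem_take]
  have := mem_limitSet_iff h (s := s) (x := i) (by omega)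
  rw [List.getD_eq_getElem _ _ (by omega)] at this
  cases hb : (σ s)[i] <;> simp [this, hb]

end SOA

/-! ### Cohesive sets -/

namespace SOA

/-- The Rasiowa–Sikorski argument: the requirements are listed, and the `n`-th is met at step `n`.
-/
theorem exists_generic {P ι : Type*} [Countable ι] [Nonempty ι] {le : P → P → Prop}
    {D : ι → P → Prop} (p : P) (h : ∀ i p, ∃ q, le q p ∧ D i q) :
    ∃ c : ℕ → P, c 0 = p ∧ (∀ n, le (c (n + 1)) (c n)) ∧ ∀ i, ∃ n, D i (c (n + 1)) := by
  obtain ⟨e, he⟩ := exists_surjective_nat ι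
  choose f hf using h
  refine ⟨fun n => Nat.rec p (fun n q => f (e n) q) n, rfl, fun n => (hf _ _).1, fun i => ?_⟩
  obtain ⟨n, rfl⟩ := he i
  exact ⟨n, (hf _ _).2⟩

/-- The string `σ s` already ensures that `r` does not compute a separation from the limit set:
either it returns a diagonal value, or it never returns a value at some place. -/
def Settled (X : ℕ → ℕ) (r : Functional) (σ : ℕ → List Bool) (s : ℕ) : Prop :=
  (∃ n b, Psi X r (σ s) n b ∧ Diag n b) ∨ ∃ n, ∀ t ≥ s, ∀ b, ¬Psi X r (σ t) n b

/-- A separation computed from the limit set is given by some functional `r`. Whatever `r` returns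
on a string of the sequence is a value of the separation, hence not diagonal, and at every place
long enough strings return a value. -/
theorem exists_unsettled {X : ℕ → ℕ} {σ : ℕ → List Bool} (hσ : ∀ s, σ s <+: σ (s + 1))
    (hl : ∀ m, ∃ s, m ≤ (σ s).length) (h : ¬NonSep (join X (chi (limitSet σ)))) :
    ∃ r, ∀ s, ¬Settled X r σ s := by
  obtain ⟨f, hf, hd⟩ := not_not.1 h
  obtain ⟨r, hr⟩ := exists_functional hf
  refine ⟨r, fun s => ?_⟩
  rintro (⟨n, b, hn, hb⟩ | ⟨n, hn⟩)
  · have : initSeg (limitSet σ) (σ s).length = σ s :=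
      (initSeg_prefix hσ le_rfl).eq_of_length (by simp [initSeg])
    exact hd n (((hr n b).2 ⟨_, this.symm ▸ hn⟩).symm ▸ hb)
  · obtain ⟨m, hm⟩ := (hr n _).1 rfl
    obtain ⟨t, ht⟩ := hl m
    have hst : m ≤ (σ (max s t)).length :=
      ht.trans (prefix_of_le hσ (le_max_right s t)).length_le
    exact hn (max s t) (le_max_left _ _) _ (hm.mono (initSeg_prefix hσ hst))

theorem limitSet_infinite {σ : ℕ → List Bool}
    (h : ∀ m, ∃ s, ∃ x ≥ m, (σ s).getD x false = true) : (limitSet σ).Infinite :=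
  Set.infinite_of_not_bddAbove fun ⟨b, hb⟩ => by
    obtain ⟨s, x, hx, hs⟩ := h (b + 1)
    have : x ≤ b := hb ⟨s, hs⟩
    omega

/-- A finite string and an infinite computable reservoir either make the functional return a
diagonal value, or make it undefined somewhere. -/
theorem exists_settling_string {X : ℕ → ℕ} (hX : NonSep X) (r : Functional) (σ : List Bool)
    {E : Set ℕ} (hE : Rec X E) :
    (∃ τ, Ext σ τ E ∧ ∃ n b, Psi X r τ n b ∧ Diag n b) ∨
      ∃ n, ∀ τ b, Ext σ τ E → ¬Psi X r τ n b := by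
  by_contra! h
  obtain ⟨h₁, h₂⟩ := h
  have h₃ : Sig X fun q : (ℕ × Bool) × List Bool => Ext σ q.2 E ∧ Psi X r q.2 q.1.1 q.1.2 :=
    (sig_ext σ (D := fun _ : ℕ × Bool => E) (sig_mem_const hE)).and
      ((sig_psi X r).comp (f := fun q : (ℕ × Bool) × List Bool => (q.2, q.1))
        (Primrec.snd.pair Primrec.fst))
  -- If both alternatives fail, the search for an extension into the computable reservoir succeeds
  -- at every place and never returns a diagonal value, so `X` itself computes a separation.
  obtain ⟨f, hf, hf'⟩ := h₃.exists.uniformize fun n => by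
    obtain ⟨τ, b, h, h'⟩ := h₂ n
    exact ⟨b, τ, h, h'⟩
  refine hX ⟨f, hf, fun n => ?_⟩
  obtain ⟨τ, h, h'⟩ := hf' n
  exact h₁ τ h n _ h'

/-- For every sequence of sets computable in `X` there is a set that is cohesive for it and does
not help `X` to separate. -/
theorem exists_cohesive {X : ℕ → ℕ} (hX : NonSep X) (R : ℕ → Set ℕ) (hR : ∀ x, Rec X (R x)) :
    ∃ C : Set ℕ, C.Infinite ∧ NonSep (join X (chi C)) ∧
      ∀ x, (∃ N, ∀ y ∈ C, N ≤ y → y ∈ R x) ∨ ∃ N, ∀ y ∈ C, N ≤ y → y ∉ R x := by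
  -- Mathias forcing with infinite reservoirs computable in `X`. The three kinds of requirement are
  -- cohesiveness, infinity and preservation of `NonSep`.
  let P := {p : List Bool × Set ℕ // p.2.Infinite ∧ Rec X p.2}
  let le : P → P → Prop := fun q p => Ext p.1.1 q.1.1 p.1.2 ∧ q.1.2 ⊆ p.1.2
  let D : ℕ ⊕ ℕ ⊕ Functional → P → Prop := fun i p => match i with
    | .inl x => p.1.2 ⊆ R x ∨ Disjoint p.1.2 (R x)
    | .inr (.inl m) => ∃ x ≥ m, p.1.1.getD x false = true
    | .inr (.inr r) => (∃ n b, Psi X r p.1.1 n b ∧ Diag n b) ∨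
        ∃ n, ∀ τ b, Ext p.1.1 τ p.1.2 → ¬Psi X r τ n b
  have dense : ∀ i p, ∃ q, le q p ∧ D i q := by
    rintro (x | m | r) ⟨⟨σ, E⟩, hinf, hE⟩
    · by_cases h : (E ∩ R x).Infinite
      · exact ⟨⟨(σ, E ∩ R x), h, hE.inter (hR x)⟩, ⟨Ext.refl _ _, Set.inter_subset_left⟩,
          Or.inl Set.inter_subset_right⟩
      · refine ⟨⟨(σ, E \ R x), ?_, hE.diff (hR x)⟩, ⟨Ext.refl _ _, Set.sdiff_subset⟩,
          Or.inr Set.disjoint_sdiff_left⟩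
        intro h'
        exact hinf (by simpa using (Set.not_infinite.1 h).union h')
    · obtain ⟨x, hx, hlt⟩ := hinf.exists_gt (max m σ.length)
      obtain ⟨τ, -, hτ, ht⟩ := exists_ext σ (x := x) (by omega)
      exact ⟨⟨(τ, E), hinf, hE⟩, ⟨hτ.mono (by simpa using hx), subset_rfl⟩, x,
        by omega, ht⟩
    · rcases exists_settling_string hX r σ hE with ⟨τ, hτ, h⟩ | h
      · exact ⟨⟨(τ, E), hinf, hE⟩, ⟨hτ, subset_rfl⟩, Or.inl h⟩
      · exact ⟨⟨(σ, E), hinf, hE⟩, ⟨Ext.refl _ _, subset_rfl⟩, Or.inr h⟩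
  obtain ⟨c, -, hc, hD⟩ := exists_generic (le := le)
    ⟨([], Set.univ), Set.infinite_univ, Sig.const True |>.of_iff (by simp),
      Sig.const False |>.of_iff (by simp)⟩ dense
  have hle : ∀ s t, s ≤ t → le (c t) (c s) := by
    intro s t hst
    induction t, hst using Nat.le_induction with
    | base => exact ⟨Ext.refl _ _, subset_rfl⟩
    | succ t _ ih => exact ⟨ih.1.trans (hc t).1 ih.2, (hc t).2.trans ih.2⟩
  let σ : ℕ → List Bool := fun s => (c s).1.1
  have hσ : ∀ s, σ s <+: σ (s + 1) := fun s => (hc s).1.1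
  have hel : ∀ m, ∃ s, ∃ x ≥ m, (σ s).getD x false = true := fun m => by
    obtain ⟨s, hs⟩ := hD (.inr (.inl m))
    exact ⟨_, hs⟩
  have hmem : ∀ s, ∀ y ∈ limitSet σ, (σ s).length ≤ y → y ∈ (c s).1.2 := by
    rintro s y ⟨t, ht⟩ hy
    have := getD_true_of_prefix (prefix_of_le hσ (le_max_right s t)) ht
    exact (hle s (max s t) (le_max_left _ _)).1.2 y hy this
  refine ⟨limitSet σ, limitSet_infinite hel, ?_, fun x => ?_⟩
  · by_contra h
    obtain ⟨r, hr⟩ := exists_unsettled hσ (fun m => by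
      obtain ⟨s, x, hx, hs⟩ := hel m
      exact ⟨s, hx.le.trans (lt_length_of_getD hs).le⟩) h
    obtain ⟨s, hs⟩ := hD (.inr (.inr r))
    refine hr (s + 1) (hs.imp id fun ⟨n, hn⟩ => ⟨n, fun t ht b => hn _ b (hle _ t ht).1⟩)
  · obtain ⟨s, hs⟩ := hD (.inl x)
    exact hs.imp (fun h => ⟨_, fun y hy hN => h (hmem _ y hy hN)⟩)
      fun h => ⟨_, fun y hy hN => Set.disjoint_left.1 h (hmem _ y hy hN)⟩

end SOA

/-! ### Two-colourings of a set: an infinite monochromatic subset that does not help to separate -/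

namespace SOA

theorem primrecPred_of_finite {α : Type} [Primcodable α] [Finite α] (p : α → Prop) :
    PrimrecPred p := by
  classical
  exact (Primrec.dom_finite fun a => decide (p a)).primrecPred

/-- A condition for building two subsets of `A false` and `A true`. It consists of finitely many
parts. Each part has two strings and a set `P i` of letters; a sequence `Y` of letters none of whose
initial segments is bad makes `{x ∈ C | P i (Y x)}` the reservoir of that part. -/
structure Cond (X : ℕ → ℕ) (A : Bool → Set ℕ) where
  ι : Type
  [fin : Finite ι]
  k : ℕ
  P : ι → Fin k → Prop
  σ : ι → Bool → List Bool
  Bad : List (Fin k) → Prop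
  sig : Sig X Bad
  ne : ∃ Y : ℕ → Fin k, ∀ n, ¬Bad (approx Y n)
  cover : ∀ a, ∃ i, P i a
  sub : ∀ i j x, (σ i j).getD x false = true → x ∈ A j

attribute [instance] Cond.fin

namespace Cond

variable {X : ℕ → ℕ} {C : Set ℕ} {A : Bool → Set ℕ}

/-- The sequences of letters admitted by a condition. -/
def seqs (c : Cond X A) : Set (ℕ → Fin c.k) := {Y | ∀ n, ¬c.Bad (approx Y n)}

/-- The reservoir of a part. -/
def res (C : Set ℕ) (c : Cond X A) (i : c.ι) (Y : ℕ → Fin c.k) : Set ℕ := {x | x ∈ C ∧ c.P i (Y x)}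

/-- Part `i'` of `d` extends part `i` of `c`. -/
def PartLE (C : Set ℕ) (d : Cond X A) (i' : d.ι) (c : Cond X A) (i : c.ι) : Prop :=
  ∀ Y' ∈ d.seqs, ∃ Y ∈ c.seqs,
    (∀ j, Ext (c.σ i j) (d.σ i' j) (c.res C i Y)) ∧ d.res C i' Y' ⊆ c.res C i Y

theorem PartLE.refl (c : Cond X A) (i : c.ι) : PartLE C c i c i :=
  fun Y hY => ⟨Y, hY, fun _ => Ext.refl _ _, subset_rfl⟩

theorem PartLE.trans {e d c : Cond X A} {i₂ : e.ι} {i₁ : d.ι} {i : c.ι}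
    (h₂ : PartLE C e i₂ d i₁) (h₁ : PartLE C d i₁ c i) : PartLE C e i₂ c i := by
  intro Y₂ hY₂
  obtain ⟨Y₁, hY₁, he₁, hr₁⟩ := h₂ Y₂ hY₂
  obtain ⟨Y, hY, he, hr⟩ := h₁ Y₁ hY₁
  exact ⟨Y, hY, fun j => (he j).trans (he₁ j) hr, hr₁.trans hr⟩

theorem PartLE.prefix {d c : Cond X A} {i' : d.ι} {i : c.ι} (h : PartLE C d i' c i) (j : Bool) :
    c.σ i j <+: d.σ i' j := by
  obtain ⟨Y, hY⟩ := d.ne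
  obtain ⟨_, _, h, _⟩ := h Y hY
  exact (h j).1

/-- `d` extends `c`: every part of `d` extends a part of `c`. -/
def LE (C : Set ℕ) (d c : Cond X A) : Prop := ∃ f : d.ι → c.ι, ∀ i, PartLE C d i c (f i)

theorem LE.refl (c : Cond X A) : LE C c c := ⟨id, PartLE.refl c⟩

theorem LE.trans {e d c : Cond X A} (h₂ : LE C e d) (h₁ : LE C d c) : LE C e c := by
  obtain ⟨f, hf⟩ := h₁
  obtain ⟨g, hg⟩ := h₂
  exact ⟨fun i => f (g i), fun i => (hg i).trans (hf _)⟩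

/-- A part is acceptable if some reservoir of it meets both colours in an infinite set. -/
def Acc (C : Set ℕ) (c : Cond X A) (i : c.ι) : Prop :=
  ∃ Y ∈ c.seqs, ∀ j, (c.res C i Y ∩ A j).Infinite

theorem PartLE.acc {d c : Cond X A} {i' : d.ι} {i : c.ι} (h : PartLE C d i' c i)
    (h' : Acc C d i') : Acc C c i := by
  obtain ⟨Y', hY', hinf⟩ := h'
  obtain ⟨Y, hY, _, hr⟩ := h Y' hY'
  exact ⟨Y, hY, fun j => (hinf j).mono (Set.inter_subset_inter_left _ hr)⟩

open Classical in
/-- Replace one string of one part, and keep only the sequences that agree with `Y` below `n`. -/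
noncomputable def upd (c : Cond X A) (i₀ : c.ι) (j₀ : Bool) (τ : List Bool) (Y : ℕ → Fin c.k) (n : ℕ)
    (hY : Y ∈ c.seqs) (hτ : ∀ x, τ.getD x false = true → x ∈ A j₀) : Cond X A where
  ι := c.ι
  k := c.k
  P := c.P
  σ i j := if i = i₀ ∧ j = j₀ then τ else c.σ i j
  Bad s := c.Bad s ∨ (n ≤ s.length ∧ ¬s.take n = approx Y n)
  sig := c.sig.or (Sig.of_primrec ((Primrec.nat_le.comp (Primrec.const n) Primrec.list_length).and
    (Primrec.eq.comp (Primrec.list_take.comp (Primrec.const n) Primrec.id)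
      (Primrec.const _)).not))
  ne := ⟨Y, fun m => by
    rintro (h | ⟨h, h'⟩)
    · exact hY m h
    · exact h' (take_approx Y (by simpa using h))⟩
  cover := c.cover
  sub i j x h := by
    split_ifs at h with hij
    · rw [hij.2]; exact hτ x h
    · exact c.sub i j x h

section upd

variable {c : Cond X A} {i₀ : c.ι} {j₀ : Bool} {τ : List Bool} {Y : ℕ → Fin c.k} {n : ℕ}
  {hY : Y ∈ c.seqs} {hτ : ∀ x, τ.getD x false = true → x ∈ A j₀}

theorem upd_self : (c.upd i₀ j₀ τ Y n hY hτ).σ i₀ j₀ = τ := by simp [upd]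

/-- The new elements of `τ` lie below `n`, where every remaining sequence agrees with `Y`; so they
belong to the reservoir given by that sequence as well. -/
theorem upd_le (hn : τ.length ≤ n) (he : Ext (c.σ i₀ j₀) τ (c.res C i₀ Y)) (i : c.ι) :
    PartLE C (c.upd i₀ j₀ τ Y n hY hτ) i c i := by
  intro (Y' : ℕ → Fin c.k) hY'
  have hY' : ∀ m, ¬(c.Bad (approx Y' m) ∨
    (n ≤ (approx Y' m).length ∧ ¬(approx Y' m).take n = approx Y n)) := hY'
  have hagree : ∀ x < n, Y' x = Y x := by
    refine eq_of_approx_eq ?_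
    by_contra h
    exact hY' n (Or.inr ⟨by simp, by rwa [take_approx _ le_rfl]⟩)
  refine ⟨Y', fun m h => hY' m (Or.inl h), fun j => ?_, subset_rfl⟩
  by_cases hij : i = i₀ ∧ j = j₀
  · obtain ⟨rfl, rfl⟩ := hij
    rw [upd_self]
    refine ⟨he.1, fun x hx ht => ?_⟩
    obtain ⟨hxC, hP⟩ := he.2 x hx ht
    exact ⟨hxC, by rwa [hagree x ((lt_length_of_getD ht).trans_le hn)]⟩
  · have : (c.upd i₀ j₀ τ Y n hY hτ).σ i j = c.σ i j := by simp only [upd]; rw [if_neg hij]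
    rw [this]
    exact Ext.refl _ _

end upd

/-- The number of parts without a property. -/
noncomputable def defect (Good : (c : Cond X A) → c.ι → Prop) (c : Cond X A) : ℕ :=
  {i | ¬Good c i}.ncard

/-- Induction on the number of parts that are not good. A step may change the index set of the
parts, but then it must make all of them good at once. -/
theorem exists_all_good {Good : (c : Cond X A) → c.ι → Prop}
    (step : ∀ c i, ¬Good c i → ∃ d, LE C d c ∧ ((∀ i, Good d i) ∨ defect Good d < defect Good c))
    (c : Cond X A) : ∃ d, LE C d c ∧ ∀ i, Good d i := by
  induction h : defect Good c using Nat.strong_induction_on generalizing c with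
  | _ N ih =>
    by_cases hc : ∀ i, Good c i
    · exact ⟨c, LE.refl c, hc⟩
    · push Not at hc
      obtain ⟨i, hi⟩ := hc
      obtain ⟨d, hd, hd' | hd'⟩ := step c i hi
      · exact ⟨d, hd, hd'⟩
      · obtain ⟨e, he, he'⟩ := ih _ (h ▸ hd') d rfl
        exact ⟨e, he.trans hd, he'⟩

/-- A step that extends one string of one part, so that this part becomes good. -/
theorem upd_step {Good : (c : Cond X A) → c.ι → Prop}
    (persist : ∀ d i' c i, PartLE C d i' c i → Good c i → Good d i')
    {c : Cond X A} {i₀ : c.ι} (hi₀ : ¬Good c i₀) {j₀ : Bool} {τ : List Bool} {Y : ℕ → Fin c.k}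
    (hY : Y ∈ c.seqs) (he : Ext (c.σ i₀ j₀) τ (c.res C i₀ Y ∩ A j₀))
    (hgood : ∀ d : Cond X A, ∀ i, PartLE C d i c i₀ → d.σ i j₀ = τ → Good d i) :
    ∃ d, LE C d c ∧ ((∀ i, Good d i) ∨ defect Good d < defect Good c) := by
  have hτ : ∀ x, τ.getD x false = true → x ∈ A j₀ := fun x hx => by
    rcases lt_or_ge x (c.σ i₀ j₀).length with h | h
    · exact c.sub i₀ j₀ x (by rwa [← getD_of_prefix he.1 h])
    · exact (he.2 x h hx).2
  have hle := fun i => upd_le (hY := hY) (hτ := hτ) (n := τ.length) le_rfl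
    (he.mono Set.inter_subset_left) i
  refine ⟨c.upd i₀ j₀ τ Y τ.length hY hτ, ⟨id, hle⟩, Or.inr ?_⟩
  refine Set.ncard_lt_ncard ⟨fun i hi h => hi (persist _ _ _ _ (hle i) h), fun h => ?_⟩
    (Set.toFinite _)
  exact h (show i₀ ∈ {i | ¬Good c i} from hi₀) (hgood _ _ (hle i₀) upd_self)

/-- Acceptable parts can be given a large element of either colour. -/
theorem exists_grow (j : Bool) (m : ℕ) (c : Cond X A) :
    ∃ d, LE C d c ∧ ∀ i, Acc C d i → ∃ x ≥ m, (d.σ i j).getD x false = true := by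
  refine exists_all_good (Good := fun (d : Cond X A) i => Acc C d i →
    ∃ x ≥ m, (d.σ i j).getD x false = true) (fun c i hi => ?_) c
  have hi' := hi
  push Not at hi
  obtain ⟨⟨Y, hY, hinf⟩, -⟩ := hi
  obtain ⟨x, hx, hlt⟩ := (hinf j).exists_gt (max m (c.σ i j).length)
  obtain ⟨τ, -, hτ, ht⟩ := exists_ext (c.σ i j) (x := x) (by omega)
  refine upd_step (fun d i' c i h hc hd => ?_) hi' (τ := τ) (j₀ := j) hY
    (hτ.mono (by simpa using hx)) fun d i _ hd _ => ⟨x, by omega, hd ▸ ht⟩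
  obtain ⟨x, hx, h'⟩ := hc (h.acc hd)
  exact ⟨x, hx, getD_true_of_prefix (h.prefix j) h'⟩

/-- The part ensures that one of two functionals does not compute a separation. -/
def Settles (C : Set ℕ) (r : Bool → Functional) (c : Cond X A) (i : c.ι) : Prop :=
  ∃ j, (∃ n b, Psi X (r j) (c.σ i j) n b ∧ Diag n b) ∨
    ∃ n, ∀ Y ∈ c.seqs, ∀ τ b, Ext (c.σ i j) τ (c.res C i Y) → ¬Psi X (r j) τ n b

theorem PartLE.settles {r : Bool → Functional} {d c : Cond X A} {i' : d.ι} {i : c.ι}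
    (h : PartLE C d i' c i) (hc : Settles C r c i) : Settles C r d i' := by
  obtain ⟨j, ⟨n, b, hn, hb⟩ | ⟨n, hn⟩⟩ := hc
  · exact ⟨j, Or.inl ⟨n, b, hn.mono (h.prefix j), hb⟩⟩
  · refine ⟨j, Or.inr ⟨n, fun Y' hY' τ b hτ => ?_⟩⟩
    obtain ⟨Y, hY, he, hr⟩ := h Y' hY'
    exact hn Y hY τ b ((he j).trans hτ hr)

/-- The string `s` of pairs of a letter and a colour is not admitted by `c`, or contains an extension
of a part, not settled yet, whose functional contradicts one of the guesses. -/
def Contradicts (C : Set ℕ) (r : Bool → Functional) (c : Cond X A)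
    (p : List (ℕ × Bool) × List (Fin c.k × Bool)) : Prop :=
  c.Bad (p.2.map Prod.fst) ∨ ∃ q : c.ι × Bool, ¬Settles C r c q.1 ∧
    ∃ τ, Ext (c.σ q.1 q.2) τ {x | x ∈ C ∧ ∃ a ∈ p.2[x]?, c.P q.1 a.1 ∧ a.2 = q.2} ∧
      ∃ e ∈ p.1, Psi X (r q.2) τ e.1 !e.2

/-- `Settles` need not be enumerable, but for the fixed condition `c` it enters only as finitely
many constant truth values. -/
theorem sig_contradicts (hC : Rec X C) (r : Bool → Functional) (c : Cond X A) :
    Sig X (Contradicts C r c) := by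
  refine Sig.or (c.sig.comp (Primrec.list_map Primrec.snd (Primrec.fst.comp Primrec.snd).to₂)) ?_
  refine Sig.exists_finite fun q => (Sig.const _).and ?_
  have hD : Sig X fun p : (List (ℕ × Bool) × List (Fin c.k × Bool)) × ℕ =>
      p.2 ∈ {x | x ∈ C ∧ ∃ a ∈ p.1.2[x]?, c.P q.1 a.1 ∧ a.2 = q.2} :=
    (hC.1.comp Primrec.snd).and (Sig.of_primrec ((primrecPred_of_finite
      fun o : Option (Fin c.k × Bool) => ∃ a ∈ o, c.P q.1 a.1 ∧ a.2 = q.2).comp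
        (Primrec.list_getElem?.comp (Primrec.snd.comp Primrec.fst) Primrec.snd)))
  have hpsi : Sig X fun p : ((List (ℕ × Bool) × List (Fin c.k × Bool)) × List Bool) × ℕ × Bool =>
      Psi X (r q.2) p.1.2 p.2.1 !p.2.2 :=
    (sig_psi X (r q.2)).comp
      (f := fun p : ((List (ℕ × Bool) × List (Fin c.k × Bool)) × List Bool) × ℕ × Bool =>
        (p.1.2, p.2.1, !p.2.2))
      ((Primrec.snd.comp Primrec.fst).pair ((Primrec.fst.comp Primrec.snd).pair
        (Primrec.not.comp (Primrec.snd.comp Primrec.snd))))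
  exact ((sig_ext (c.σ q.1 q.2) (D := fun p : List (ℕ × Bool) × List (Fin c.k × Bool) =>
    {x | x ∈ C ∧ ∃ a ∈ p.2[x]?, c.P q.1 a.1 ∧ a.2 = q.2}) hD).and (hpsi.exists_mem (Primrec.fst.comp Primrec.fst))).exists

/-- The hypothesis holds for all colourings, in particular for the true one. The string found then
stays inside `A j`, and since the contradicted guess is correct, the value returned is a diagonal
value. The part was unsettled before, so the defect drops. -/
theorem settle_of_correct {r : Bool → Functional} (hCA : C ⊆ A false ∪ A true) (c : Cond X A)
    {v : List (ℕ × Bool)} (hv : Correct v)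
    (hW : ∀ Y : ℕ → Fin c.k × Bool, ∃ n, Contradicts C r c (v, approx Y n)) :
    ∃ d, LE C d c ∧
      ((∀ i, Settles C r d i) ∨ defect (Settles C r) d < defect (Settles C r) c) := by
  classical
  obtain ⟨Y, hY⟩ := c.ne
  obtain ⟨n, h | ⟨⟨i, j⟩, hi, τ, hτ, e, he, hpsi⟩⟩ := hW fun x => (Y x, decide (x ∈ A true))
  · rw [map_approx] at h
    exact absurd h (hY n)
  · refine upd_step (fun d i' c i => PartLE.settles) hi (τ := τ) (j₀ := j) hY (hτ.mono ?_)
      fun d i _ hd => ⟨j, Or.inl ⟨_, _, hd ▸ hpsi, hv e he⟩⟩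
    rintro x ⟨hx, a, ha, hP, rfl⟩
    obtain ⟨hl, ha⟩ := List.getElem?_eq_some_iff.1 (Option.mem_def.1 ha)
    rw [getElem_approx] at ha
    subst ha
    refine ⟨⟨hx, hP⟩, ?_⟩
    by_cases ht : x ∈ A true
    · simp [ht]
    · simpa [ht] using (hCA hx).resolve_right ht

/-- For each list of guesses at the places `a` some sequence of letters and colours admits no
contradiction. The new condition carries such a sequence for every list simultaneously. -/
theorem settle_of_avoiding (hC : Rec X C) {r : Bool → Functional} (c : Cond X A) {N : ℕ}
    (hN : Nat.card (c.ι × Bool) < 2 ^ N) {a : List ℕ} (ha : a.length = N)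
    (hW : ∀ b : List Bool, b.length = N →
      ∃ Y : ℕ → Fin c.k × Bool, ∀ n, ¬Contradicts C r c (a.zip b, approx Y n)) :
    ∃ d, LE C d c ∧ ∀ i, Settles C r d i := by
  classical
  have := Fintype.ofFinite c.ι
  -- A new letter codes one pair of an old letter and a colour for each of the `2 ^ N` lists of
  -- guesses.
  let e : ((Fin N → Bool) → Fin c.k × Bool) ≃ Fin (Fintype.card ((Fin N → Bool) → Fin c.k × Bool)) :=
    Fintype.equivFin _
  choose Y hY using fun b : Fin N → Bool => hW (List.ofFn b) (by simp)
  let d : Cond X A :=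
    { ι := c.ι × Bool × {w : (Fin N → Bool) × (Fin N → Bool) // w.1 ≠ w.2}
      k := _
      -- A new part consists of an old part, a colour and two different lists of guesses; its
      -- reservoir consists of the elements of `C` to which both lists assign that part and that
      -- colour.
      P := fun i u => ∀ b, b = i.2.2.1.1 ∨ b = i.2.2.1.2 →
        c.P i.1 (e.symm u b).1 ∧ (e.symm u b).2 = i.2.1
      σ := fun i => c.σ i.1
      Bad := fun s => ∃ b : Fin N → Bool,
        Contradicts C r c (a.zip (List.ofFn b), s.map fun u => e.symm u b)
      sig := Sig.exists_finite fun b => (sig_contradicts hC r c).comp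
        ((Primrec.const _).pair (Primrec.list_map Primrec.id
          ((Primrec.dom_finite fun u => e.symm u b).comp Primrec.snd).to₂))
      ne := ⟨fun x => e fun b => Y b x, fun n ⟨b, hb⟩ => hY b n (by simpa [map_approx] using hb)⟩
      cover := fun u => by
        choose i hi using fun b => c.cover (e.symm u b).1
        -- There are more lists of guesses than pairs of a part and a colour, so two lists choose
        -- the same pair.
        have : ¬Function.Injective fun b => (i b, (e.symm u b).2) := fun h => by
          have := Nat.card_le_card_of_injective _ h
          simp only [Nat.card_eq_fintype_card, Fintype.card_fun, Fintype.card_bool,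
            Fintype.card_fin] at this hN
          omega
        simp only [Function.Injective, not_forall] at this
        obtain ⟨p, q, hpq, hne⟩ := this
        obtain ⟨h₁, h₂⟩ := Prod.mk.inj hpq
        refine ⟨(i p, (e.symm u p).2, ⟨(p, q), hne⟩), ?_⟩
        rintro b (rfl | rfl)
        · exact ⟨hi _, rfl⟩
        · refine ⟨?_, h₂.symm⟩
          simp only [h₁]
          exact hi _
      sub := fun i => c.sub i.1 }
  have hle : ∀ i : d.ι, PartLE C d i c i.1 := by
    intro i Y' hY'
    refine ⟨fun x => (e.symm (Y' x) i.2.2.1.1).1, fun n h => hY' n ⟨i.2.2.1.1, Or.inl ?_⟩,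
      fun _ => Ext.refl _ _, fun x hx => ⟨hx.1, (hx.2 _ (Or.inl rfl)).1⟩⟩
    simpa [map_approx] using h
  refine ⟨d, ⟨_, hle⟩, fun i' => ?_⟩
  by_cases hs : Settles C r c i'.1
  · exact (hle i').settles hs
  obtain ⟨i, j, ⟨⟨p, q⟩, hpq⟩⟩ := i'
  obtain ⟨t, ht⟩ := Function.ne_iff.1 hpq
  refine ⟨j, Or.inr ⟨a[t], fun Y' hY' τ b hτ hpsi => ?_⟩⟩
  -- The lists `p` and `q` differ at `t`, so any value at `a[t]` contradicts one of them. The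
  -- reservoir lies inside both sequences, and neither admits a contradiction; hence no value is
  -- returned.
  obtain ⟨w, hw, hb⟩ : ∃ w, (w = p ∨ w = q) ∧ b = !w t := by
    by_cases h : b = !p t
    · exact ⟨p, Or.inl rfl, h⟩
    · refine ⟨q, Or.inr rfl, ?_⟩
      simp only at ht
      revert h ht
      cases b <;> cases p t <;> cases q t <;> simp
  subst hb
  refine hY' τ.length ⟨w, Or.inr ⟨(i, j), hs, τ, ⟨hτ.1, fun x hx hx' => ?_⟩, (a[t], w t), ?_, hpsi⟩⟩
  · obtain ⟨hxC, hP⟩ := hτ.2 x hx hx'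
    refine ⟨hxC, e.symm (Y' x) w, ?_, hP w hw⟩
    simp [approx, lt_length_of_getD hx']
  · refine List.mem_iff_getElem.2 ⟨t, by simp [ha], ?_⟩
    simp

/-- Every condition extends to one all of whose parts settle a given pair of functionals. -/
theorem exists_settles (hX : NonSep X) (hC : Rec X C) (hCA : C ⊆ A false ∪ A true)
    (r : Bool → Functional) (c : Cond X A) : ∃ d, LE C d c ∧ ∀ i, Settles C r d i := by
  refine exists_all_good (fun c i _ => ?_) c
  have : Nonempty (Fin c.k × Bool) := ⟨(c.ne.choose 0, true)⟩
  -- `Y` ranges over all pairs of a sequence of letters and a colouring, not only over the true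
  -- colouring; by compactness the lists `v` contradicted for every `Y` are enumerable in `X`.
  by_cases h : ∃ v, Correct v ∧ ∀ Y : ℕ → Fin c.k × Bool, ∃ n, Contradicts C r c (v, approx Y n)
  · obtain ⟨v, hv, hW⟩ := h
    exact settle_of_correct hCA c hv hW
  · push Not at h
    obtain ⟨a, ha, hW⟩ := exists_tuple_avoiding hX (Nat.card (c.ι × Bool))
      (fun v => ∀ Y : ℕ → Fin c.k × Bool, ∃ n, Contradicts C r c (v, approx Y n))
      (sig_contradicts hC r c).forall_seq fun v hW hv => by
        obtain ⟨Y, hY⟩ := h v hv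
        obtain ⟨n, hn⟩ := hW Y
        exact hY n hn
    obtain ⟨d, hd, hd'⟩ := settle_of_avoiding hC c Nat.lt_two_pow_self ha fun b hb => by
      simpa using hW b hb
    exact ⟨d, hd, Or.inl hd'⟩

end Cond

end SOA

/-! ### Existence of acceptable parts by a Baire category argument. -/

namespace SOA

namespace Cond

variable {X : ℕ → ℕ} {C : Set ℕ} {A : Bool → Set ℕ}

theorem exists_cylinder {β : Type} [TopologicalSpace β] [DiscreteTopology β] {U : Set (ℕ → β)}
    (hU : IsOpen U) {Y : ℕ → β} (hY : Y ∈ U) :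
    ∃ n, ∀ Z : ℕ → β, approx Z n = approx Y n → Z ∈ U := by
  obtain ⟨I, u, hu, hI⟩ := isOpen_pi_iff.1 hU Y hY
  refine ⟨I.sup id + 1, fun Z hZ => hI fun i hi => ?_⟩
  rw [eq_of_approx_eq hZ i (Nat.lt_succ_of_le (Finset.le_sup (f := id) hi))]
  exact (hu i hi).2

theorem isClosed_seqs (c : Cond X A) : IsClosed c.seqs := by
  have : c.seqs = ⋂ n, {Y | c.Bad (approx Y n)}ᶜ := by ext; simp [seqs]
  rw [this]
  exact isClosed_iInter fun n => (isOpen_approx _ n).isClosed_compl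

/-- If no part is acceptable, then every admitted sequence computes the colouring from some point
on. -/
theorem exists_letters (hCA : C ⊆ A false ∪ A true)
    {c : Cond X A} (h : ∀ i, ¬Acc C c i) {Y : ℕ → Fin c.k} (hY : Y ∈ c.seqs) :
    ∃ (B : Set (Fin c.k)) (N : ℕ), ∀ x ∈ C, N ≤ x → (x ∈ A false ↔ Y x ∈ B) := by
  have hfin : ∀ i, ∃ j, (c.res C i Y ∩ A j).Finite := fun i => by
    by_contra! hi
    exact h i ⟨Y, hY, hi⟩
  have hbdd : ∃ N, ∀ i j, (c.res C i Y ∩ A j).Finite → ∀ x ∈ c.res C i Y ∩ A j, x < N := by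
    have : (⋃ q ∈ {q : c.ι × Bool | (c.res C q.1 Y ∩ A q.2).Finite},
        c.res C q.1 Y ∩ A q.2).Finite :=
      (Set.toFinite _).biUnion fun q hq => hq
    obtain ⟨N, hN⟩ := this.bddAbove
    refine ⟨N + 1, fun i j hij x hx => Nat.lt_succ_of_le (hN ?_)⟩
    exact Set.mem_iUnion₂.2 ⟨(i, j), hij, hx⟩
  obtain ⟨N, hN⟩ := hbdd
  -- Each part meets one of the two colours in a finite set. The letters collected are those of the
  -- parts that meet `A true` finitely; beyond `N` these finite intersections are exhausted.
  refine ⟨{a | ∃ i, c.P i a ∧ (c.res C i Y ∩ A true).Finite}, N, fun x hx hNx => ⟨fun hxA => ?_, ?_⟩⟩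
  · obtain ⟨i, hi⟩ := c.cover (Y x)
    obtain ⟨j, hj⟩ := hfin i
    cases j
    · have := hN i false hj x ⟨⟨hx, hi⟩, hxA⟩
      omega
    · exact ⟨i, hi, hj⟩
  · rintro ⟨i, hi, hfi⟩
    refine (hCA hx).resolve_right fun hxA => ?_
    have := hN i true hfi x ⟨⟨hx, hi⟩, hxA⟩
    omega

/-- The admitted sequences form a nonempty compact space, covered by the countably many closed sets
on which a fixed `B` and `N` work. By Baire's theorem one of these sets contains a cylinder. -/
theorem exists_uniform_letters (hCA : C ⊆ A false ∪ A true)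
    {c : Cond X A} (h : ∀ i, ¬Acc C c i) :
    ∃ Y ∈ c.seqs, ∃ (B : Set (Fin c.k)) (N n : ℕ), ∀ Z ∈ c.seqs, approx Z n = approx Y n →
      ∀ x ∈ C, N ≤ x → (x ∈ A false ↔ Z x ∈ B) := by
  have hcomp : CompactSpace c.seqs := isCompact_iff_compactSpace.1 c.isClosed_seqs.isCompact
  have hne : Nonempty c.seqs := ⟨⟨_, c.ne.choose_spec⟩⟩
  let F : Set (Fin c.k) × ℕ → Set c.seqs := fun p =>
    {Y | ∀ x ∈ C, p.2 ≤ x → (x ∈ A false ↔ Y.1 x ∈ p.1)}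
  have hF : ∀ p, IsClosed (F p) := by
    intro p
    have : F p = ⋂ x, ⋂ (_ : x ∈ C), ⋂ (_ : p.2 ≤ x),
        (fun Y : c.seqs => Y.1 x) ⁻¹' {a | x ∈ A false ↔ a ∈ p.1} := by
      ext; simp [F]
    rw [this]
    exact isClosed_iInter fun x => isClosed_iInter fun _ => isClosed_iInter fun _ =>
      (isClosed_discrete _).preimage ((continuous_apply x).comp continuous_subtype_val)
  have hU : ⋃ p, F p = Set.univ := Set.eq_univ_of_forall fun Y => by
    obtain ⟨B, N, hBN⟩ := exists_letters hCA h Y.2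
    exact Set.mem_iUnion.2 ⟨(B, N), hBN⟩
  obtain ⟨⟨B, N⟩, Y, hY⟩ := nonempty_interior_of_iUnion_of_closed hF hU
  obtain ⟨V, hV, hVo, hYV⟩ := mem_interior.1 hY
  obtain ⟨U, hUo, rfl⟩ := isOpen_induced_iff.1 hVo
  obtain ⟨n, hn⟩ := exists_cylinder hUo hYV
  exact ⟨Y, Y.2, B, N, n, fun Z hZ hZY => hV (show (⟨Z, hZ⟩ : c.seqs) ∈ Subtype.val ⁻¹' U from hn Z hZY)⟩

/-- Being forced by an admitted cylinder is recursively enumerable. -/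
theorem sig_forced (c : Cond X A) (Y : ℕ → Fin c.k) (n : ℕ) (B : Set (Fin c.k)) :
    Sig X fun x => ∀ Z ∈ c.seqs, approx Z n = approx Y n → Z x ∈ B := by
  have : Nonempty (Fin c.k) := ⟨Y 0⟩
  have h : Sig X fun p : ℕ × List (Fin c.k) => (c.Bad p.2 ∨
      (n ≤ p.2.length ∧ ¬p.2.take n = approx Y n)) ∨ ∃ a ∈ p.2[p.1]?, a ∈ B := by
    refine Sig.or (Sig.or (c.sig.comp Primrec.snd) (Sig.of_primrec ?_)) (Sig.of_primrec ?_)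
    · exact (Primrec.nat_le.comp (Primrec.const n) (Primrec.list_length.comp Primrec.snd)).and
        (Primrec.eq.comp (Primrec.list_take.comp (Primrec.const n) Primrec.snd)
          (Primrec.const _)).not
    · exact (primrecPred_of_finite fun o : Option (Fin c.k) => ∃ a ∈ o, a ∈ B).comp
        (Primrec.list_getElem?.comp Primrec.snd Primrec.fst)
  refine h.forall_seq.of_iff fun x => ⟨fun H Z => ?_, fun H Z hZ hZY => ?_⟩
  · by_cases hZ : Z ∈ c.seqs
    · by_cases hZY : approx Z n = approx Y n
      · exact ⟨x + 1, Or.inr ⟨Z x, by simp [approx], H Z hZ hZY⟩⟩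
      · exact ⟨n, Or.inl (Or.inr ⟨by simp, by simpa [take_approx _ le_rfl] using hZY⟩)⟩
    · simp only [seqs, Set.mem_ofPred_eq, not_forall, not_not] at hZ
      obtain ⟨m, hm⟩ := hZ
      exact ⟨m, Or.inl (Or.inl hm)⟩
  · obtain ⟨m, (hm | ⟨hm, hm'⟩) | ⟨a, ha, haB⟩⟩ := H Z
    · exact absurd hm (hZ m)
    · exact absurd (by rw [take_approx _ (by simpa using hm), hZY]) hm'
    · obtain ⟨hl, ha⟩ := List.getElem?_eq_some_iff.1 (Option.mem_def.1 ha)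
      rw [getElem_approx] at ha
      rwa [ha]

/-- If the colouring is not computable, every condition has an acceptable part. -/
theorem exists_acc (hC : Rec X C) (hCA : C = A false ∪ A true)
    (hA : ¬Rec X (A false)) (c : Cond X A) : ∃ i, Acc C c i := by
  by_contra! h
  -- On the cylinder, beyond `N`, the colour of an element of `C` is the one forced by all admitted
  -- sequences. Both "forced into `B`" and "forced into the complement of `B`" are enumerable, so
  -- the colouring would be computable.
  obtain ⟨Y, hY, B, N, n, H⟩ := exists_uniform_letters hCA.subset h
  refine hA ?_
  have hlt : Rec X {x | x < N} := Rec.of_primrec (Primrec.nat_lt.comp Primrec.id (Primrec.const N))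
  have hsmall : Rec X (A false ∩ {x | x < N}) :=
    Rec.of_finite ((Set.finite_lt_nat N).subset Set.inter_subset_right)
  constructor
  · refine ((hsmall.1).or (hlt.2.and (hC.1.and (sig_forced c Y n B)))).of_iff fun x => ?_
    by_cases hx : x < N
    · exact ⟨fun h => Or.inl ⟨h, hx⟩, fun h => h.elim (fun h => h.1) fun h => absurd hx h.1⟩
    · have hx' : N ≤ x := not_lt.1 hx
      refine ⟨fun hxA => ?_, ?_⟩
      · have hxC : x ∈ C := hCA ▸ Or.inl hxA
        exact Or.inr ⟨hx, hxC, fun Z hZ hZY => (H Z hZ hZY x hxC hx').1 hxA⟩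
      · rintro (⟨-, h⟩ | ⟨-, hxC, hf⟩)
        · exact absurd h hx
        · exact (H Y hY rfl x hxC hx').2 (hf Y hY rfl)
  · refine ((hsmall.2.and hlt.1).or (hlt.2.and (hC.2.or (sig_forced c Y n Bᶜ)))).of_iff fun x => ?_
    by_cases hx : x < N
    · exact ⟨fun h => Or.inl ⟨fun h' => h h'.1, hx⟩,
        fun h => h.elim (fun h h' => h.1 ⟨h', hx⟩) fun h => absurd hx h.1⟩
    · have hx' : N ≤ x := not_lt.1 hx
      refine ⟨fun hxA => Or.inr ⟨hx, ?_⟩, ?_⟩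
      · by_cases hxC : x ∈ C
        · exact Or.inr fun Z hZ hZY hB => hxA ((H Z hZ hZY x hxC hx').2 hB)
        · exact Or.inl hxC
      · rintro (⟨-, h⟩ | ⟨-, hxC | hf⟩) hxA
        · exact hx h
        · exact hxC (hCA ▸ Or.inl hxA)
        · exact hf Y hY rfl ((H Y hY rfl x (hCA ▸ Or.inl hxA) hx').1 hxA)

end Cond

/-! ### König's lemma for the parts, and the generic sets. -/

theorem exists_forall_of_antitone {ι : Type} [Finite ι] {Q : ℕ → ι → Prop}
    (anti : ∀ m i, Q (m + 1) i → Q m i) (h : ∀ m, ∃ i, Q m i) : ∃ i, ∀ m, Q m i := by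
  by_contra! H
  choose f hf using H
  have := Fintype.ofFinite ι
  obtain ⟨i, hi⟩ := h (Finset.univ.sup f)
  have anti' : ∀ m n, m ≤ n → Q n i → Q m i := fun m n hmn => by
    induction n, hmn using Nat.le_induction with
    | base => exact id
    | succ n _ ih => exact fun h => ih (anti n i h)
  exact hf i (anti' _ _ (Finset.le_sup (Finset.mem_univ i)) hi)

/-- A tree given by finite levels and a parent map, with a distinguished nonempty subtree. -/
theorem exists_branch {ι : ℕ → Type} [∀ n, Finite (ι n)] (f : ∀ n, ι (n + 1) → ι n)
    (T : ∀ n, ι n → Prop) (hT : ∀ n i, T (n + 1) i → T n (f n i)) (hne : ∀ n, ∃ i, T n i) :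
    ∃ b : ∀ n, ι n, ∀ n, T n (b n) ∧ f n (b (n + 1)) = b n := by
  -- `Q m n i` says that `i` has a descendant in `T` exactly `m` levels further on. The branch runs
  -- through nodes for which this holds for every `m`.
  let Q : ℕ → ∀ n, ι n → Prop :=
    fun m => Nat.rec (fun n i => T n i) (fun _ R n i => ∃ i', f n i' = i ∧ R (n + 1) i') m
  have hex : ∀ m n, ∃ i, Q m n i := by
    intro m
    induction m with
    | zero => exact hne
    | succ m ih => exact fun n => (ih (n + 1)).elim fun i hi => ⟨f n i, i, rfl, hi⟩
  have anti : ∀ m n i, Q (m + 1) n i → Q m n i := by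
    intro m
    induction m with
    | zero => rintro n _ ⟨i', rfl, h⟩; exact hT n i' h
    | succ m ih => rintro n i ⟨i', h, h'⟩; exact ⟨i', h, ih _ _ h'⟩
  have start := exists_forall_of_antitone (fun m i => anti m 0 i) (fun m => hex m 0)
  have next : ∀ n (i : {i : ι n // ∀ m, Q m n i}),
      ∃ i' : {i : ι (n + 1) // ∀ m, Q m (n + 1) i}, f n i'.1 = i.1 := by
    rintro n ⟨i, hi⟩
    obtain ⟨i', hi'⟩ := exists_forall_of_antitone (Q := fun m i' => f n i' = i ∧ Q m (n + 1) i')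
      (fun m i' h => ⟨h.1, anti m _ _ h.2⟩) (fun m => hi (m + 1))
    exact ⟨⟨i', fun m => (hi' m).2⟩, (hi' 0).1⟩
  choose g hg using next
  let b : ∀ n, {i : ι n // ∀ m, Q m n i} := fun n => Nat.rec ⟨_, start.choose_spec⟩ g n
  exact ⟨fun n => (b n).1, fun n => ⟨(b n).2 0, hg n (b n)⟩⟩

open Cond in
/-- Every two-colouring of an infinite set `C` computable in `X`, where `X` does not separate, has
an infinite monochromatic set that does not help `X` to separate. -/
theorem exists_monochromatic {X : ℕ → ℕ} (hX : NonSep X) {C : Set ℕ} (hC : Rec X C)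
    (hinf : C.Infinite) {A : Bool → Set ℕ} (hCA : C = A false ∪ A true)
    (hdis : Disjoint (A false) (A true)) :
    ∃ j, ∃ G ⊆ A j, G.Infinite ∧ NonSep (join X (chi G)) := by
  -- If the partition is computable, an infinite side serves as `G`. Otherwise every condition has
  -- an acceptable part.
  by_cases hA : Rec X (A false)
  · have hA' : Rec X (A true) := by
      have : A true = C \ A false := by
        rw [hCA, Set.union_sdiff_left, hdis.sdiff_eq_right]
      rw [this]
      exact hC.diff hA
    have : (A false).Infinite ∨ (A true).Infinite := Set.infinite_union.1 (hCA ▸ hinf)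
    rcases this with h | h
    · exact ⟨false, _, subset_rfl, h, hX.of_red ((Red.refl X).join hA.red)⟩
    · exact ⟨true, _, subset_rfl, h, hX.of_red ((Red.refl X).join hA'.red)⟩
  have hacc := exists_acc hC hCA hA
  let D : (Bool × ℕ) ⊕ (Functional × Functional) → Cond X A → Prop := fun q d => match q with
    | .inl (j, m) => ∀ i, Acc C d i → ∃ x ≥ m, (d.σ i j).getD x false = true
    | .inr (r, r') => ∀ i, Settles C (fun j => bif j then r' else r) d i
  let c₀ : Cond X A :=
    { ι := Unit
      k := 1
      P := fun _ _ => True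
      σ := fun _ _ => []
      Bad := fun _ => False
      sig := Sig.const False
      ne := ⟨fun _ => 0, fun _ => id⟩
      cover := fun _ => ⟨(), trivial⟩
      sub := fun _ _ x h => by simp at h }
  have hrne : Nonempty ((Bool × ℕ) ⊕ (Functional × Functional)) := ⟨.inl (true, 0)⟩
  obtain ⟨c, -, hc, hD⟩ := exists_generic (le := LE C) (D := D) c₀ (by
    rintro (⟨j, m⟩ | ⟨r, r'⟩) c
    · exact exists_grow j m c
    · exact exists_settles hX hC hCA.subset _ c)
  choose f hf using hc
  -- Acceptability is inherited by the part that is extended, so the acceptable parts form a tree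
  -- with finite levels.
  obtain ⟨b, hb⟩ := exists_branch f (fun n i => Acc C (c n) i) (fun n i => (hf n i).acc)
    fun n => hacc _
  have hstep : ∀ n, PartLE C (c (n + 1)) (b (n + 1)) (c n) (b n) := fun n => by
    have := hf n (b (n + 1))
    rwa [(hb n).2] at this
  have hle : ∀ s t, s ≤ t → PartLE C (c t) (b t) (c s) (b s) := fun s t hst => by
    induction t, hst using Nat.le_induction with
    | base => exact PartLE.refl _ _
    | succ t _ ih => exact (hstep t).trans ih
  let σ : Bool → ℕ → List Bool := fun j s => (c s).σ (b s) j
  have hσ : ∀ j s, σ j s <+: σ j (s + 1) := fun j s => (hstep s).prefix j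
  have hgrow : ∀ j m, ∃ s, ∃ x ≥ m, (σ j s).getD x false = true := fun j m => by
    obtain ⟨n, hn⟩ := hD (.inl (j, m))
    exact ⟨n + 1, hn _ (hb _).1⟩
  by_contra! H
  have hbad : ∀ j, ∃ r, ∀ s, ¬Settled X r (σ j) s := fun j => by
    refine exists_unsettled (hσ j) (fun m => ?_) (H j (limitSet (σ j)) ?_
      (limitSet_infinite (hgrow j)))
    · obtain ⟨s, x, hx, hs⟩ := hgrow j m
      exact ⟨s, hx.le.trans (lt_length_of_getD hs).le⟩
    · rintro x ⟨s, hs⟩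
      exact (c s).sub _ _ _ hs
  choose r hr using hbad
  -- If both limit sets helped to separate, each would have an unsettled functional. This pair is
  -- one of the requirements, and the part on the branch settles it for some `j`.
  obtain ⟨n, hn⟩ := hD (.inr (r false, r true))
  obtain ⟨j, hj⟩ := hn (b (n + 1))
  have hrj : (bif j then r true else r false) = r j := by cases j <;> rfl
  simp only [hrj] at hj
  refine hr j (n + 1) (hj.imp id fun ⟨p, hp⟩ => ⟨p, fun t ht d => ?_⟩)
  obtain ⟨Y', hY'⟩ := (c t).ne
  obtain ⟨Y, hY, he, -⟩ := hle _ t ht Y' hY'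
  exact hp Y hY _ d (he j)

end SOA

/-! ### Homogeneous sets, and a Turing ideal closed under them -/

namespace SOA

/-- The set selected greedily from `G` so that all pairs satisfy `E`. -/
theorem exists_greedy (G : Set ℕ) (E : ℕ × ℕ → Prop) :
    ∃ H : Set ℕ, ∀ x, x ∈ H ↔ x ∈ G ∧ ∀ y < x, y ∈ H → E (y, x) := by
  let F : (x : ℕ) → ((y : ℕ) → y < x → Prop) → Prop :=
    fun x ih => x ∈ G ∧ ∀ y, ∀ h : y < x, ih y h → E (y, x)
  refine ⟨{x | WellFounded.fix Nat.lt_wfRel.wf F x}, fun x => ?_⟩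
  have := WellFounded.fix_eq Nat.lt_wfRel.wf F x
  exact this.to_iff

/-- A string is `Good` when every bit is justified by the earlier ones. Good strings are initial
segments of `H`, are enumerable, and exist in every length, so either value of a bit can be found by
search. -/
theorem rec_greedy {X : ℕ → ℕ} {G H : Set ℕ} {E : ℕ × ℕ → Prop} (hG : Rec X G) (hE : Sig X E)
    (hE' : Sig X fun p => ¬E p) (hH : ∀ x, x ∈ H ↔ x ∈ G ∧ ∀ y < x, y ∈ H → E (y, x)) :
    Rec X H := by
  classical
  let Good : List Bool → Prop := fun s => ∀ i < s.length,
    (s.getD i false = true ∧ i ∈ G ∧ ∀ y < i, s.getD y false = false ∨ E (y, i)) ∨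
      (s.getD i false = false ∧ (i ∉ G ∨ ∃ y ∈ List.range i, s.getD y false = true ∧ ¬E (y, i)))
  have hgood : Sig X Good := by
    have hbit : ∀ b : Bool, PrimrecPred fun q : List Bool × ℕ => q.1.getD q.2 false = b := fun b =>
      Primrec.eq.comp ((Primrec.list_getD false).comp Primrec.fst Primrec.snd) (Primrec.const b)
    have hsw : Primrec fun q : (List Bool × ℕ) × ℕ => (q.2, q.1.2) :=
      Primrec.snd.pair (Primrec.snd.comp Primrec.fst)
    have hsb : Primrec fun q : (List Bool × ℕ) × ℕ => (q.1.1, q.2) :=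
      (Primrec.fst.comp Primrec.fst).pair Primrec.snd
    refine Sig.forall_lt (P := fun q : List Bool × ℕ =>
      (q.1.getD q.2 false = true ∧ q.2 ∈ G ∧ ∀ y < q.2, q.1.getD y false = false ∨ E (y, q.2)) ∨
      (q.1.getD q.2 false = false ∧
        (q.2 ∉ G ∨ ∃ y ∈ List.range q.2, q.1.getD y false = true ∧ ¬E (y, q.2))))
      ?_ Primrec.list_length
    refine Sig.or ((Sig.of_primrec (hbit true)).and ((hG.1.comp Primrec.snd).and ?_))
      ((Sig.of_primrec (hbit false)).and ((hG.2.comp Primrec.snd).or ?_))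
    · exact Sig.forall_lt (P := fun q : (List Bool × ℕ) × ℕ =>
          q.1.1.getD q.2 false = false ∨ E (q.2, q.1.2))
        ((Sig.of_primrec ((hbit false).comp hsb)).or (hE.comp hsw)) Primrec.snd
    · exact Sig.exists_mem (P := fun q : (List Bool × ℕ) × ℕ =>
          q.1.1.getD q.2 false = true ∧ ¬E (q.2, q.1.2))
        ((Sig.of_primrec ((hbit true).comp hsb)).and (hE'.comp hsw))
        (Primrec.list_range.comp Primrec.snd)
  have hspec : ∀ s, Good s → ∀ i < s.length, (s.getD i false = true ↔ i ∈ H) := by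
    intro s hs i
    induction i using Nat.strong_induction_on with
    | _ i ih =>
      intro hi
      rw [hH]
      rcases hs i hi with ⟨h, hG, hy⟩ | ⟨h, hG⟩
      · refine ⟨fun _ => ⟨hG, fun y hyi hyH => ?_⟩, fun _ => h⟩
        rw [← ih y hyi (hyi.trans hi)] at hyH
        exact (hy y hyi).resolve_left (by rw [hyH]; decide)
      · refine ⟨fun h' => absurd (h.symm.trans h') Bool.false_ne_true, fun ⟨h₁, h₂⟩ => ?_⟩
        rcases hG with hG | ⟨y, hy, hy', hE⟩
        · exact absurd h₁ hG
        · have hyi : y < i := by simpa using hy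
          exact absurd (h₂ y hyi ((ih y hyi (hyi.trans hi)).1 hy')) hE
  have hex : ∀ m, Good (initSeg H m) := by
    intro m i hi
    have hm : ∀ y < m, ((initSeg H m).getD y false = true ↔ y ∈ H) := fun y hy => by
      simp only [initSeg]; rw [getD_approx _ hy]; simp
    have hi : i < m := by simpa [initSeg] using hi
    by_cases h : i ∈ H
    · refine Or.inl ⟨(hm i hi).2 h, ((hH i).1 h).1, fun y hy => ?_⟩
      by_cases hy' : y ∈ H
      · exact Or.inr (((hH i).1 h).2 y hy hy')
      · exact Or.inl (by rw [← Bool.not_eq_true, hm y (hy.trans hi)]; exact hy')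
    · refine Or.inr ⟨by rw [← Bool.not_eq_true, hm i hi]; exact h, ?_⟩
      by_contra hc
      push Not at hc
      refine h ((hH i).2 ⟨hc.1, fun y hy hyH => ?_⟩)
      exact hc.2 y (by simpa using hy) ((hm y (hy.trans hi)).2 hyH)
  have hval : ∀ b : Bool, Sig X fun x : ℕ =>
      ∃ s : List Bool, Good s ∧ x < s.length ∧ s.getD x false = b := fun b => by
    refine Sig.exists (P := fun q : ℕ × List Bool =>
      Good q.2 ∧ q.1 < q.2.length ∧ q.2.getD q.1 false = b) ((hgood.comp Primrec.snd).and
      (Sig.of_primrec ?_))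
    exact (Primrec.nat_lt.comp Primrec.fst (Primrec.list_length.comp Primrec.snd)).and
      (Primrec.eq.comp ((Primrec.list_getD false).comp Primrec.snd Primrec.fst) (Primrec.const b))
  have hm : ∀ x, ((initSeg H (x + 1)).getD x false = true ↔ x ∈ H) := fun x =>
    hspec _ (hex _) x (by simp [initSeg])
  refine ⟨(hval true).of_iff fun x => ⟨fun h => ⟨_, hex (x + 1), by simp [initSeg], (hm x).2 h⟩, ?_⟩,
    (hval false).of_iff fun x => ⟨fun h => ⟨_, hex (x + 1), by simp [initSeg], ?_⟩, ?_⟩⟩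
  · rintro ⟨s, hs, hx, h⟩
    exact (hspec s hs x hx).1 h
  · rw [← Bool.not_eq_true, hm]; exact h
  · rintro ⟨s, hs, hx, h⟩ hxH
    rw [(hspec s hs x hx).2 hxH] at h
    exact Bool.false_ne_true h.symm

/-- If `H` were finite, the thresholds of its elements would have a common bound, and any larger
element of `G` beyond `H` would have been selected. -/
theorem greedy_infinite {C G H : Set ℕ} {E : ℕ × ℕ → Prop} (hGC : G ⊆ C) (hG : G.Infinite)
    (hE : ∀ y ∈ G, ∃ N, ∀ x ∈ C, N ≤ x → E (y, x))
    (hH : ∀ x, x ∈ H ↔ x ∈ G ∧ ∀ y < x, y ∈ H → E (y, x)) : H.Infinite := by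
  intro hfin
  choose! N hN using hE
  obtain ⟨M, hM⟩ := (hfin.image N).bddAbove
  obtain ⟨M', hM'⟩ := hfin.bddAbove
  obtain ⟨x, hx, hlt⟩ := hG.exists_gt (max M M')
  have hxH : x ∈ H := (hH x).2 ⟨hx, fun y _ hy =>
    hN y ((hH y).1 hy).1 x (hGC hx) ((hM (Set.mem_image_of_mem N hy)).trans (by omega))⟩
  have := hM' hxH
  omega

/-- Ramsey's theorem for pairs does not help to separate. -/
theorem exists_homogeneous {X : ℕ → ℕ} (hX : NonSep X) {f : ℕ × ℕ → Prop} (hf : Sig X f)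
    (hf' : Sig X fun p => ¬f p) : ∃ Y, NonSep Y ∧ Red Y X ∧ ∃ H : Set ℕ, Rec Y H ∧ H.Infinite ∧
      ((∀ x ∈ H, ∀ y ∈ H, x < y → f (x, y)) ∨ ∀ x ∈ H, ∀ y ∈ H, x < y → ¬f (x, y)) := by
  -- Cohesiveness for the rows makes the colour of `(x, y)` eventually constant as `y` runs through
  -- `C`; `A j` collects the `x` with limit colour `j`.
  obtain ⟨C, hCinf, hC, hcoh⟩ := exists_cohesive hX (fun x => {y | f (x, y)}) fun x =>
    ⟨hf.comp ((Primrec.const x).pair Primrec.id), hf'.comp ((Primrec.const x).pair Primrec.id)⟩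
  let E : Bool → ℕ × ℕ → Prop := fun j p => bif j then ¬f p else f p
  let A : Bool → Set ℕ := fun j => {x | x ∈ C ∧ ∃ N, ∀ y ∈ C, N ≤ y → E j (x, y)}
  have hCA : C = A false ∪ A true := by
    ext x
    refine ⟨fun hx => (hcoh x).imp (fun h => ⟨hx, h⟩) fun h => ⟨hx, h⟩, ?_⟩
    rintro (h | h) <;> exact h.1
  have hdis : Disjoint (A false) (A true) := by
    refine Set.disjoint_left.2 fun x ⟨_, N, hN⟩ ⟨_, N', hN'⟩ => ?_
    obtain ⟨y, hy, hlt⟩ := hCinf.exists_gt (max N N')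
    exact hN' y hy (by omega) (hN y hy (by omega))
  obtain ⟨j, G, hGA, hGinf, hG⟩ :=
    exists_monochromatic hC (rec_of_red red_join_right) hCinf hCA hdis
  have hred : Red (join (join X (chi C)) (chi G)) X := red_join_left.trans red_join_left
  obtain ⟨H, hH⟩ := exists_greedy G (E j)
  have hEs : Sig (join (join X (chi C)) (chi G)) (E j) := by
    cases j
    · exact hf.trans hred
    · exact hf'.trans hred
  have hEs' : Sig (join (join X (chi C)) (chi G)) fun p => ¬E j p := by
    cases j
    · exact hf'.trans hred
    · exact (hf.trans hred).of_iff fun p => not_not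
  refine ⟨_, hG, hred, H, rec_greedy (rec_of_red red_join_right) hEs hEs' hH,
    greedy_infinite (fun x hx => (hGA hx).1) hGinf (fun y hy => (hGA hy).2) hH, ?_⟩
  have hhom : ∀ x ∈ H, ∀ y ∈ H, x < y → E j (x, y) := fun x hx y hy hxy =>
    ((hH y).1 hy).2 x hxy hx
  cases j
  · exact Or.inl hhom
  · exact Or.inr hhom

/-- The number `(t + u)² + t`. -/
def pr (t u : ℕ) : ℕ := (t + u) * (t + u) + t

theorem primrec_pr : Primrec₂ pr :=
  Primrec.nat_add.comp (Primrec.nat_mul.comp Primrec.nat_add Primrec.nat_add) Primrec.fst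

/-- `F` codes a colouring of the pairs `x < y` by `1` and `2`. -/
def IsColouring (F : Set ℕ) : Prop := ∀ x y, x < y →
  (pr (pr x y) 1 ∈ F ∨ pr (pr x y) 2 ∈ F) ∧ ¬(pr (pr x y) 1 ∈ F ∧ pr (pr x y) 2 ∈ F)

/-- All pairs `x < y` in `H` have the same colour. -/
def Homogeneous (H F : Set ℕ) : Prop := ∃ c, ∀ x ∈ H, ∀ y ∈ H, x < y → pr (pr x y) c ∈ F

theorem exists_solution {X : ℕ → ℕ} (hX : NonSep X) {F : Set ℕ} (hF : Rec X F)
    (hcol : IsColouring F) :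
    ∃ Y, NonSep Y ∧ Red Y X ∧ ∃ H, Rec Y H ∧ H.Infinite ∧ Homogeneous H F := by
  have hp : Primrec fun p : ℕ × ℕ => pr (pr p.1 p.2) 1 :=
    primrec_pr.comp (primrec_pr.comp Primrec.fst Primrec.snd) (Primrec.const 1)
  obtain ⟨Y, hY, hYX, H, hH, hinf, h⟩ := exists_homogeneous hX
    (f := fun p => pr (pr p.1 p.2) 1 ∈ F) (hF.1.comp hp) (hF.2.comp hp)
  refine ⟨Y, hY, hYX, H, hH, hinf, ?_⟩
  rcases h with h | h
  · exact ⟨1, h⟩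
  · exact ⟨2, fun x hx y hy hxy => (hcol x y hxy).1.resolve_left (h x hx y hy hxy)⟩

/-- It is harmless that the list also contains sets that are merely enumerable in `X`: those that
are not computable are ignored later. -/
theorem exists_enumeration (X : ℕ → ℕ) : ∃ e : ℕ → Set ℕ, ∀ F, Rec X F → ∃ n, e n = F := by
  have := countable_primrecPred (α := ℕ × List ℕ)
  have hne : Nonempty {p : ℕ × List ℕ → Prop // PrimrecPred p} :=
    ⟨⟨fun p => p.1 = p.1, Primrec.eq.comp Primrec.fst Primrec.fst⟩⟩
  obtain ⟨e, he⟩ := exists_surjective_nat {p : ℕ × List ℕ → Prop // PrimrecPred p}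
  refine ⟨fun n => {a | ∃ k, (e n).1 (a, approx X k)}, fun F hF => ?_⟩
  obtain ⟨R, hR, h⟩ := hF.1
  obtain ⟨n, hn⟩ := he ⟨R, hR⟩
  refine ⟨n, Set.ext fun a => ?_⟩
  simp only [hn]
  exact (h a).symm

/-- An increasing sequence of oracles, none of which separates, such that every colouring computable
in one of them has an infinite homogeneous set computable in one of them. -/
theorem exists_oracles : ∃ X : ℕ → ℕ → ℕ, (∀ n, NonSep (X n)) ∧ (∀ m n, m ≤ n → Red (X n) (X m)) ∧
    ∀ n F, Rec (X n) F → IsColouring F → ∃ m H, Rec (X m) H ∧ H.Infinite ∧ Homogeneous H F := by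
  let S := {X : ℕ → ℕ // NonSep X}
  have hnext : ∀ (X : S) (F : Set ℕ), ∃ Y : S, Red Y.1 X.1 ∧ (Rec X.1 F → IsColouring F →
      ∃ H, Rec Y.1 H ∧ H.Infinite ∧ Homogeneous H F) := by
    intro X F
    by_cases h : Rec X.1 F ∧ IsColouring F
    · obtain ⟨Y, hY, hYX, hH⟩ := exists_solution X.2 h.1 h.2
      exact ⟨⟨Y, hY⟩, hYX, fun _ _ => hH⟩
    · exact ⟨X, Red.refl _, fun h₁ h₂ => absurd ⟨h₁, h₂⟩ h⟩
  choose next hred hsol using hnext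
  choose e he using exists_enumeration
  -- `T n` is a table whose entries up to `n` are final. Entry `n + 1` treats the set numbered
  -- `n.unpair.2` for entry `n.unpair.1`; the latter index is at most `n`, and every pair of indices
  -- occurs.
  let T : ℕ → ℕ → S := fun n => Nat.rec (fun _ => ⟨_, nonSep_zero⟩)
    (fun n f => Function.update f (n + 1) (next (f n) (e (f n.unpair.1).1 n.unpair.2))) n
  have hT : ∀ n, T (n + 1) = Function.update (T n) (n + 1)
    (next (T n n) (e (T n n.unpair.1).1 n.unpair.2)) := fun _ => rfl
  have hstable : ∀ m n, m ≤ n → T n m = T m m := by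
    intro m n hmn
    induction n, hmn using Nat.le_induction with
    | base => rfl
    | succ n h ih => rw [hT, Function.update_of_ne (by omega), ih]
  have hstep : ∀ n, T (n + 1) (n + 1) = next (T n n) (e (T n n.unpair.1).1 n.unpair.2) := fun n => by
    rw [hT, Function.update_self]
  have hmono : ∀ m n, m ≤ n → Red (T n n).1 (T m m).1 := by
    intro m n hmn
    induction n, hmn using Nat.le_induction with
    | base => exact Red.refl _
    | succ n h ih => rw [hstep]; exact (hred _ _).trans ih
  refine ⟨fun n => (T n n).1, fun n => (T n n).2, hmono, fun m F hF hcol => ?_⟩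
  obtain ⟨k, hk⟩ := he _ F hF
  have hle : m ≤ Nat.pair m k := Nat.left_le_pair m k
  have := hsol (T (Nat.pair m k) (Nat.pair m k)) F (hF.trans (hmono _ _ hle)) hcol
  refine ⟨Nat.pair m k + 1, ?_⟩
  simp only at hk ⊢
  rw [hstep, Nat.unpair_pair, hstable m _ hle, hk]
  exact this

end SOA

/-! ### The ω-model given by an increasing sequence of oracles -/

namespace SOA

/-- The sets computable in one of the oracles. -/
def ideal (X : ℕ → ℕ → ℕ) : Set (Set ℕ) := {B | ∃ n, Rec (X n) B}

/-- The values in `l`, followed by those of `e`. -/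
def asg (e : ℕ → ℕ) (l : List ℕ) : ℕ → ℕ := l.foldr cons e

@[simp] theorem asg_cons (e : ℕ → ℕ) (a : ℕ) (l : List ℕ) : asg e (a :: l) = cons a (asg e l) := rfl

theorem asg_eq_getD (e : ℕ → ℕ) (l : List ℕ) : ∀ i N, i < N → asg e l i = (l ++ approx e N).getD i 0 := by
  induction l with
  | nil => intro i N h; simp only [List.nil_append]; rw [getD_approx e h]; rfl
  | cons a l ih =>
    intro i N h
    cases i with
    | zero => rfl
    | succ i => exact ih i N (by omega)

theorem primrec_val (e : ℕ → ℕ) (t : Term) : Primrec fun l : List ℕ => t.val (asg e l) := by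
  induction t with
  | var i =>
    refine Primrec.of_eq ((Primrec.list_getD 0).comp
      (Primrec.list_append.comp Primrec.id (Primrec.const (approx e (i + 1)))) (Primrec.const i))
      fun l => ?_
    exact (asg_eq_getD e l i (i + 1) (by omega)).symm
  | zero => exact Primrec.const 0
  | one => exact Primrec.const 1
  | add t u iht ihu => exact Primrec.nat_add.comp iht ihu
  | mul t u iht ihu => exact Primrec.nat_mul.comp iht ihu

section

variable {X : ℕ → ℕ → ℕ} (hX : ∀ m n, m ≤ n → Red (X n) (X m))
include hX

/-- Bounded formulas with parameters from the ideal define computable relations. -/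
theorem IsBounded.sig {θ : Fml} (hθ : IsBounded θ) {I : Set (Set ℕ)} (e : ℕ → ℕ) {μ : ℕ → Set ℕ}
    (hμ : ∀ k, μ k ∈ ideal X) :
    ∃ n, Sig (X n) (fun l : List ℕ => θ.True I (asg e l) μ) ∧
      Sig (X n) fun l : List ℕ => ¬θ.True I (asg e l) μ := by
  induction hθ with
  | eq t u =>
    have h := Primrec.eq.comp (primrec_val e t) (primrec_val e u)
    exact ⟨0, Sig.of_primrec h, Sig.of_primrec h.not⟩
  | lt t u =>
    have h := Primrec.nat_lt.comp (primrec_val e t) (primrec_val e u)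
    exact ⟨0, Sig.of_primrec h, Sig.of_primrec h.not⟩
  | mem t k =>
    obtain ⟨n, hn⟩ := hμ k
    exact ⟨n, hn.1.comp (primrec_val e t), hn.2.comp (primrec_val e t)⟩
  | fls => exact ⟨0, Sig.const False, (Sig.const True).of_iff fun l => by simp⟩
  | @imp φ ψ _ _ ihφ ihψ =>
    obtain ⟨m, hm, hm'⟩ := ihφ
    obtain ⟨n, hn, hn'⟩ := ihψ
    have h₁ := hX m (max m n) (le_max_left _ _)
    have h₂ := hX n (max m n) (le_max_right _ _)
    refine ⟨max m n, ((hm'.trans h₁).or (hn.trans h₂)).of_iff fun l => ?_,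
      ((hm.trans h₁).and (hn'.trans h₂)).of_iff fun l => ?_⟩
    · rw [true_imp]; tauto
    · rw [true_imp]; tauto
  | @ball t φ _ ih =>
    obtain ⟨n, hn, hn'⟩ := ih
    have hc : Primrec fun q : List ℕ × ℕ => q.2 :: q.1 :=
      Primrec.list_cons.comp Primrec.snd Primrec.fst
    refine ⟨n, ((hn.comp hc).forall_lt (primrec_val e t)).of_iff fun l => ?_,
      ((hn'.comp hc).exists_mem (Primrec.list_range.comp (primrec_val e t))).of_iff fun l => ?_⟩
    · simp
    · simp

/-- The `Σ⁰₁` definition enumerates the set and the `Π⁰₁` one its complement. The finitely many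
parameters used lie below a common oracle of the increasing sequence. -/
theorem true_delta1_comprehension {φ ψ : Fml} (hφ : IsSigma1 φ) (hψ : IsPi1 ψ) {ν : ℕ → ℕ}
    {μ : ℕ → Set ℕ} (hμ : ∀ k, μ k ∈ ideal X) :
    (Fml.allN (φ ⇔ₗ ψ) ⇒ₗ Fml.exS (Fml.allN (Term.var 0 ∈ₛ 0 ⇔ₗ φ.liftS))).True (ideal X) ν μ := by
  obtain ⟨θ, hθ, rfl⟩ := hφ
  obtain ⟨θ', hθ', rfl⟩ := hψ
  rw [true_imp, true_allN, true_exS]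
  intro h
  simp only [true_iff, true_exN, true_allN] at h
  refine ⟨{x | ∃ y, θ.True (ideal X) (cons y (cons x ν)) μ}, ?_, ?_⟩
  · obtain ⟨m, hm, -⟩ := hθ.sig hX (I := ideal X) ν hμ
    obtain ⟨n, -, hn⟩ := hθ'.sig hX (I := ideal X) ν hμ
    have h₁ := hX m (max m n) (le_max_left _ _)
    have h₂ := hX n (max m n) (le_max_right _ _)
    have hc : Primrec fun q : ℕ × ℕ => [q.2, q.1] :=
      Primrec.list_cons.comp Primrec.snd (Primrec.list_cons.comp Primrec.fst (Primrec.const []))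
    refine ⟨max m n, ((hm.trans h₁).comp hc).exists,
      ((hn.trans h₂).comp hc).exists.of_iff fun x => ?_⟩
    change (¬∃ y, θ.True (ideal X) (cons y (cons x ν)) μ) ↔
      ∃ y, ¬θ'.True (ideal X) (cons y (cons x ν)) μ
    rw [h x, not_forall]
  · rw [true_allN]
    intro x
    rw [true_iff, true_liftS, true_exN]
    rfl

theorem true_RCA0 {φ : Fml} (hφ : φ ∈ RCA0) (ν : ℕ → ℕ) (μ : ℕ → Set ℕ)
    (hμ : ∀ k, μ k ∈ ideal X) : φ.True (ideal X) ν μ := by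
  cases hφ with
  | succ_ne_zero => simp
  | succ_inj => simp
  | add_zero => simp
  | add_succ => simp [add_assoc]
  | mul_zero => simp
  | mul_succ => simp [Nat.mul_succ]
  | not_lt_zero => simp
  | lt_succ => simp [Nat.le_iff_lt_or_eq]
  -- The numbers are standard, so induction holds for every formula.
  | sigma1_induction φ _ =>
    rw [true_imp, true_and, true_instN, true_allN, true_allN]
    rintro ⟨h₀, h⟩ x
    induction x with
    | zero => exact h₀
    | succ x ih =>
      have := h x ih
      rw [true_subst, cons_comp (fun t : Term => t.val (cons x ν))] at this
      exact this
  | delta1_comprehension φ ψ h₁ h₂ => exact true_delta1_comprehension hX h₁ h₂ hμ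

end

@[simp] theorem val_pair {ν : ℕ → ℕ} (t u : Term) : (pair t u).val ν = pr (t.val ν) (u.val ν) := by
  simp [pair, pr]

theorem true_isColoring {I : Set (Set ℕ)} {ν : ℕ → ℕ} {μ : ℕ → Set ℕ} {F : ℕ}
    (h : (isColoring F).True I ν μ) : IsColouring (μ F) := by
  intro x y hxy
  have := h
  rw [isColoring, true_and] at this
  have := this.2 x y
  simpa [exactlyOne, hxy] using this

theorem true_RT22 {X : ℕ → ℕ → ℕ}
    (h : ∀ n F, Rec (X n) F → IsColouring F → ∃ m H, Rec (X m) H ∧ H.Infinite ∧ Homogeneous H F)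
    (ν : ℕ → ℕ) (μ : ℕ → Set ℕ) : RT22.True (ideal X) ν μ := by
  rw [RT22, true_allS]
  rintro F ⟨n, hF⟩
  rw [true_imp, true_exS]
  intro hcol
  obtain ⟨m, H, hH, hinf, c, hc⟩ := h n F hF (true_isColoring hcol)
  refine ⟨H, ⟨m, hH⟩, ?_⟩
  rw [true_and]
  constructor
  · simp only [infinite, true_allN, true_exN, true_and, true_lt, true_mem, val_var, cons_one,
      cons_zero]
    intro k
    obtain ⟨x, hx, hlt⟩ := hinf.exists_gt k
    exact ⟨x, hlt, hx⟩
  · simp only [isHomogeneous, true_allN, true_exN, true_and, true_lt, true_mem, val_var, cons_one,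
      cons_zero, cons_two, true_imp, val_pair]
    exact ⟨c, fun x y ⟨hx, hy, hxy⟩ => hc x hx y hy hxy⟩

end SOA

/-! ### A computable tree whose paths are separations -/

namespace SOA

theorem le_pr_left (t u : ℕ) : t ≤ pr t u := Nat.le_add_left _ _

theorem le_pr_right (t u : ℕ) : u ≤ pr t u := by
  unfold pr; nlinarith [Nat.zero_le (t * u), Nat.le_mul_self (t + u)]

theorem pr_inj {t u t' u' : ℕ} (h : pr t u = pr t' u') : t = t' ∧ u = u' := by
  -- The value `pr a b` lies between the squares of `a + b` and `a + b + 1`.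
  have key : ∀ a b : ℕ, Nat.sqrt (pr a b) = a + b := fun a b => Nat.sqrt_add_eq _ (by omega)
  have h₁ := key t u
  rw [h, key] at h₁
  unfold pr at h
  rw [h₁] at h
  omega

/-- `s` codes a triple. -/
def IsTriple (s : ℕ) : Prop := ∃ k m n, s = pr k (pr m n)

/-- `x` belongs to the finite set coded by `s`. -/
def Elem (x s : ℕ) : Prop :=
  ∃ k m n q, s = pr k (pr m n) ∧ x < k ∧ q * (m * (x + 1) + 1) = n

/-- `s` is the least code of a finite set. -/
def FinCode (s : ℕ) : Prop :=
  IsTriple s ∧ ∀ t < s, IsTriple t → ¬∀ x, Elem x t ↔ Elem x s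

/-- `s` codes a binary sequence of length `l`. -/
def BinSeq (s l : ℕ) : Prop :=
  FinCode s ∧ (∀ x, Elem x s → ∃ i < l, x = pr i 0 ∨ x = pr i 1) ∧
    ∀ i < l, (Elem (pr i 0) s ∨ Elem (pr i 1) s) ∧ ¬(Elem (pr i 0) s ∧ Elem (pr i 1) s)

section

variable {I : Set (Set ℕ)} {ν : ℕ → ℕ} {μ : ℕ → Set ℕ}

@[simp] theorem true_isTriple (s : Term) : (isTriple s).True I ν μ ↔ IsTriple (s.val ν) := by
  simp [isTriple, IsTriple]

@[simp] theorem true_elem (x s : Term) : (elem x s).True I ν μ ↔ Elem (x.val ν) (s.val ν) := by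
  simp [elem, Elem]

@[simp] theorem true_isFinCode (s : Term) : (isFinCode s).True I ν μ ↔ FinCode (s.val ν) := by
  simp [isFinCode, FinCode]

@[simp] theorem true_isBinSeq (s l : Term) :
    (isBinSeq s l).True I ν μ ↔ BinSeq (s.val ν) (l.val ν) := by
  simp [isBinSeq, BinSeq, exactlyOne]

end

theorem Elem.lt {x s : ℕ} (h : Elem x s) : x < s := by
  obtain ⟨k, m, n, q, rfl, hx, -⟩ := h
  exact hx.trans_le (le_pr_left _ _)

theorem elem_pr {x k m n : ℕ} : Elem x (pr k (pr m n)) ↔ x < k ∧ (m * (x + 1) + 1) ∣ n := by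
  constructor
  · rintro ⟨k', m', n', q, h, hx, hq⟩
    obtain ⟨hk, h⟩ := pr_inj h
    obtain ⟨hm, hn⟩ := pr_inj h
    subst hk hm hn
    exact ⟨hx, Dvd.intro_left q hq⟩
  · rintro ⟨hx, q, hq⟩
    exact ⟨k, m, n, q, rfl, hx, by rw [hq, mul_comm]⟩

/-- Gödel's coding with `m = k!`. A prime dividing the moduli of `x < y < k` divides `m * (y - x)`,
hence `m` because `y - x < k`, hence `1`. So the product of the moduli of the elements of `D` is
divisible by no other modulus below `k`. -/
theorem exists_triple (D : Finset ℕ) : ∃ s, IsTriple s ∧ ∀ x, Elem x s ↔ x ∈ D := by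
  let k := D.sup id + 1
  have hk : ∀ x ∈ D, x < k := fun x hx => Nat.lt_succ_of_le (Finset.le_sup (f := id) hx)
  let m := k.factorial
  have hcop : ∀ x < k, ∀ y < k, x ≠ y → Nat.Coprime (m * (x + 1) + 1) (m * (y + 1) + 1) := by
    intro x hx y hy hxy
    wlog hlt : x < y generalizing x y
    · exact (this y hy x hx hxy.symm (by omega)).symm
    refine Nat.coprime_of_dvd fun p hp h₁ h₂ => ?_
    have hd : p ∣ m * (y - x) := by
      have : m * (y + 1) + 1 - (m * (x + 1) + 1) = m * (y - x) := by
        obtain ⟨d, rfl⟩ := Nat.exists_eq_add_of_lt hlt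
        have e₁ : x + d + 1 - x = d + 1 := by omega
        rw [e₁]
        have e₂ : m * (x + d + 1 + 1) + 1 = m * (x + 1) + 1 + m * (d + 1) := by ring
        rw [e₂]
        omega
      rw [← this]
      exact Nat.dvd_sub h₂ h₁
    have hm : p ∣ m := by
      rcases hp.dvd_mul.1 hd with h | h
      · exact h
      · exact h.trans (Nat.dvd_factorial (by omega) (by omega))
    have : p ∣ 1 := (Nat.dvd_add_right (hm.mul_right _)).1 h₁
    exact hp.one_lt.ne' (Nat.dvd_one.1 this)
  refine ⟨pr k (pr m (∏ y ∈ D, (m * (y + 1) + 1))), ⟨_, _, _, rfl⟩, fun x => ?_⟩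
  rw [elem_pr]
  constructor
  · rintro ⟨hx, hd⟩
    by_contra hxD
    have hc : Nat.Coprime (m * (x + 1) + 1) (∏ y ∈ D, (m * (y + 1) + 1)) :=
      Nat.Coprime.prod_right fun y hy => hcop x hx y (hk y hy) fun h => hxD (h ▸ hy)
    have := Nat.Coprime.eq_one_of_dvd hc hd
    have hm : 0 < m := Nat.factorial_pos k
    have : 0 < m * (x + 1) := by positivity
    omega
  · intro hx
    exact ⟨hk x hx, Finset.dvd_prod_of_mem _ hx⟩

theorem exists_finCode (D : Finset ℕ) : ∃ s, FinCode s ∧ ∀ x, Elem x s ↔ x ∈ D := by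
  classical
  have h := exists_triple D
  obtain ⟨h₁, h₂⟩ := Nat.find_spec h
  refine ⟨Nat.find h, ⟨h₁, fun t ht ht' hx => Nat.find_min h ht ⟨ht', fun x => ?_⟩⟩, h₂⟩
  rw [hx, h₂]

theorem BinSeq.le_of_subset {s s' l l' : ℕ} (h : BinSeq s l) (h' : BinSeq s' l')
    (hs : ∀ x, Elem x s' → Elem x s) : l' ≤ l := by
  by_contra hlt
  rcases (h'.2.2 l (by omega)).1 with hx | hx
  all_goals
    obtain ⟨i, hi, he | he⟩ := h.2.1 _ (hs _ hx)
    all_goals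
      have := (pr_inj he).1
      omega

theorem BinSeq.length_le {s l : ℕ} (h : BinSeq s l) : l ≤ s := by
  cases l with
  | zero => exact Nat.zero_le s
  | succ l =>
    rcases (h.2.2 l (Nat.lt_succ_self l)).1 with hx | hx
    all_goals exact (le_pr_left _ _).trans_lt hx.lt

/-- The codes of the sequences that avoid the diagonal values found within their length. -/
def diagTree : Set ℕ :=
  {s | ∃ l, BinSeq s l ∧ ∀ i < l, ∀ t < l, ∀ b, diagStage t i b → ¬Elem (pr i b.toNat) s}

/-! ### Primitive recursiveness of the coding and of the tree. -/

section primrec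

variable {α : Type} [Primcodable α]

theorem _root_.PrimrecPred.exists_lt' {p : α × ℕ → Prop} (hp : PrimrecPred p) {f : α → ℕ}
    (hf : Primrec f) : PrimrecPred fun a => ∃ k < f a, p (a, k) :=
  primrec_exists_lt (R := fun k a => p (a, k)) (hp.comp (Primrec.snd.pair Primrec.fst)) hf

theorem _root_.PrimrecPred.forall_lt' {p : α × ℕ → Prop} (hp : PrimrecPred p) {f : α → ℕ}
    (hf : Primrec f) : PrimrecPred fun a => ∀ k < f a, p (a, k) :=
  primrec_forall_lt (R := fun k a => p (a, k)) (hp.comp (Primrec.snd.pair Primrec.fst)) hf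

theorem _root_.PrimrecPred.imp {p q : α → Prop} (hp : PrimrecPred p) (hq : PrimrecPred q) :
    PrimrecPred fun a => p a → q a :=
  (hp.not.or hq).of_eq fun _ => imp_iff_not_or.symm

/-- All four witnesses are bounded by the code, since `pr` dominates its arguments and the quotient
is at most `n`. -/
theorem primrecPred_elem : PrimrecPred fun p : ℕ × ℕ => Elem p.1 p.2 := by
  have x₁ : Primrec fun p : ((((ℕ × ℕ) × ℕ) × ℕ) × ℕ) × ℕ => p.1.1.1.1 :=
    Primrec.fst.comp (Primrec.fst.comp (Primrec.fst.comp Primrec.fst))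
  have k₁ : Primrec fun p : ((((ℕ × ℕ) × ℕ) × ℕ) × ℕ) × ℕ => p.1.1.1.2 :=
    Primrec.snd.comp (Primrec.fst.comp (Primrec.fst.comp Primrec.fst))
  have m₁ : Primrec fun p : ((((ℕ × ℕ) × ℕ) × ℕ) × ℕ) × ℕ => p.1.1.2 :=
    Primrec.snd.comp (Primrec.fst.comp Primrec.fst)
  have n₁ : Primrec fun p : ((((ℕ × ℕ) × ℕ) × ℕ) × ℕ) × ℕ => p.1.2 :=
    Primrec.snd.comp Primrec.fst
  have h : PrimrecPred fun p : ((((ℕ × ℕ) × ℕ) × ℕ) × ℕ) × ℕ =>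
      p.1.1.1.1.2 = pr p.1.1.1.2 (pr p.1.1.2 p.1.2) ∧ p.1.1.1.1.1 < p.1.1.1.2 ∧
        p.2 * (p.1.1.2 * (p.1.1.1.1.1 + 1) + 1) = p.1.2 :=
    (Primrec.eq.comp (Primrec.snd.comp x₁)
      (primrec_pr.comp k₁ (primrec_pr.comp m₁ n₁))).and
    ((Primrec.nat_lt.comp (Primrec.fst.comp x₁) k₁).and
      (Primrec.eq.comp (Primrec.nat_mul.comp Primrec.snd (Primrec.succ.comp
        (Primrec.nat_mul.comp m₁ (Primrec.succ.comp (Primrec.fst.comp x₁))))) n₁))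
  have b₀ : Primrec fun p : ℕ × ℕ => p.2 + 1 := Primrec.succ.comp Primrec.snd
  refine ((((h.exists_lt' (b₀.comp (Primrec.fst.comp (Primrec.fst.comp Primrec.fst)))).exists_lt'
    (b₀.comp (Primrec.fst.comp Primrec.fst))).exists_lt' (b₀.comp Primrec.fst)).exists_lt'
    b₀).of_eq fun p => ?_
  constructor
  · rintro ⟨k, -, m, -, n, -, q, -, h⟩
    exact ⟨k, m, n, q, h⟩
  · rintro ⟨k, m, n, q, hs, hx, hq⟩
    have h₁ := le_pr_left k (pr m n)
    have h₂ := le_pr_right k (pr m n)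
    have h₃ := le_pr_left m n
    have h₄ := le_pr_right m n
    have h₅ : q ≤ n := by rw [← hq]; exact Nat.le_mul_of_pos_right q (Nat.succ_pos _)
    dsimp only at hs ⊢
    exact ⟨k, by omega, m, by omega, n, by omega, q, by omega, hs, hx, hq⟩

theorem primrecPred_isTriple : PrimrecPred IsTriple := by
  have h : PrimrecPred fun p : ((ℕ × ℕ) × ℕ) × ℕ => p.1.1.1 = pr p.1.1.2 (pr p.1.2 p.2) :=
    Primrec.eq.comp (Primrec.fst.comp (Primrec.fst.comp Primrec.fst))
      (primrec_pr.comp (Primrec.snd.comp (Primrec.fst.comp Primrec.fst))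
        (primrec_pr.comp (Primrec.snd.comp Primrec.fst) Primrec.snd))
  refine (((h.exists_lt' (Primrec.succ.comp (Primrec.fst.comp Primrec.fst))).exists_lt'
    (Primrec.succ.comp Primrec.fst)).exists_lt' Primrec.succ).of_eq fun s => ?_
  constructor
  · rintro ⟨k, -, m, -, n, -, h⟩
    exact ⟨k, m, n, h⟩
  · rintro ⟨k, m, n, h⟩
    have h₁ := le_pr_left k (pr m n)
    have h₂ := le_pr_right k (pr m n)
    have h₃ := le_pr_left m n
    have h₄ := le_pr_right m n
    exact ⟨k, by simp only [Nat.succ_eq_add_one]; omega, m, by simp only [Nat.succ_eq_add_one]; omega,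
      n, by simp only [Nat.succ_eq_add_one]; omega, h⟩

theorem primrecPred_finCode : PrimrecPred FinCode := by
  have e₁ : PrimrecPred fun p : (ℕ × ℕ) × ℕ => Elem p.2 p.1.2 :=
    primrecPred_elem.comp (Primrec.snd.pair (Primrec.snd.comp Primrec.fst))
  have e₂ : PrimrecPred fun p : (ℕ × ℕ) × ℕ => Elem p.2 p.1.1 :=
    primrecPred_elem.comp (Primrec.snd.pair (Primrec.fst.comp Primrec.fst))
  have h := (primrecPred_isTriple.comp Primrec.snd).imp
    (((e₁.imp e₂).and (e₂.imp e₁)).forall_lt' (Primrec.fst (α := ℕ) (β := ℕ))).not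
  refine (primrecPred_isTriple.and (h.forall_lt' Primrec.id)).of_eq fun s => ?_
  refine and_congr_right fun _ => forall_congr' fun t => forall_congr' fun ht =>
    imp_congr_right fun _ => not_congr ?_
  simp only [id] at ht
  constructor
  · intro H x
    by_cases hx : x < s
    · exact ⟨(H x hx).1, (H x hx).2⟩
    · exact ⟨fun h => absurd (h.lt.trans ht) hx, fun h => absurd h.lt hx⟩
  · exact fun H x _ => ⟨(H x).1, (H x).2⟩

theorem primrecPred_binSeq : PrimrecPred fun p : ℕ × ℕ => BinSeq p.1 p.2 := by
  have c : ∀ b, PrimrecPred fun q : ((ℕ × ℕ) × ℕ) × ℕ => q.1.2 = pr q.2 b := fun b =>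
    Primrec.eq.comp (Primrec.snd.comp Primrec.fst)
      (primrec_pr.comp Primrec.snd (Primrec.const b))
  have d : ∀ b, PrimrecPred fun q : (ℕ × ℕ) × ℕ => Elem (pr q.2 b) q.1.1 := fun b =>
    primrecPred_elem.comp ((primrec_pr.comp Primrec.snd (Primrec.const b)).pair
      (Primrec.fst.comp Primrec.fst))
  have e : PrimrecPred fun q : (ℕ × ℕ) × ℕ => Elem q.2 q.1.1 :=
    primrecPred_elem.comp (Primrec.snd.pair (Primrec.fst.comp Primrec.fst))
  have h₁ := (e.imp (((c 0).or (c 1)).exists_lt' (Primrec.snd.comp Primrec.fst))).forall_lt'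
    (Primrec.fst (α := ℕ) (β := ℕ))
  have h₂ := (((d 0).or (d 1)).and ((d 0).and (d 1)).not).forall_lt'
    (Primrec.snd (α := ℕ) (β := ℕ))
  refine ((primrecPred_finCode.comp Primrec.fst).and (h₁.and h₂)).of_eq fun p => ?_
  refine and_congr_right fun _ => and_congr_left fun _ => ?_
  exact ⟨fun H x hx => H x hx.lt hx, fun H x _ hx => H x hx⟩

theorem primrecPred_diagTree : PrimrecPred (· ∈ diagTree) := by
  have hb : ∀ b, PrimrecPred fun q : ((ℕ × ℕ) × ℕ) × ℕ =>
      diagStage q.2 q.1.2 b → ¬Elem (pr q.1.2 b.toNat) q.1.1.1 := fun b =>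
    (primrec_diagStage.comp (Primrec.snd.pair ((Primrec.snd.comp Primrec.fst).pair
      (Primrec.const b)))).imp (primrecPred_elem.comp ((primrec_pr.comp
        (Primrec.snd.comp Primrec.fst) (Primrec.const b.toNat)).pair
        (Primrec.fst.comp (Primrec.fst.comp Primrec.fst)))).not
  have h := (((hb false).and (hb true)).forall_lt' (Primrec.snd.comp Primrec.fst)).forall_lt'
    (Primrec.snd (α := ℕ) (β := ℕ))
  refine ((primrecPred_binSeq.and h).exists_lt' Primrec.succ).of_eq fun s => ?_
  constructor
  · rintro ⟨l, -, hl, H⟩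
    refine ⟨l, hl, fun i hi t ht b => ?_⟩
    cases b
    exacts [(H i hi t ht).1, (H i hi t ht).2]
  · rintro ⟨l, hl, H⟩
    exact ⟨l, Nat.lt_succ_of_le hl.length_le, hl,
      fun i hi t ht => ⟨H i hi t ht false, H i hi t ht true⟩⟩

end primrec

/-- A function avoiding the diagonal exists, though not computably. Its initial segments lie in the
tree, and a code is at least as large as the length it codes. -/
theorem diagTree_unbounded (N : ℕ) : ∃ s ∈ diagTree, N < s := by
  classical
  let h : ℕ → Bool := fun i => decide (¬Diag i true)
  have hh : ∀ i, ¬Diag i (h i) := fun i hi => by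
    by_cases ht : Diag i true
    · have hf : h i = false := decide_eq_false (not_not.2 ht)
      rw [hf] at hi
      exact Bool.false_ne_true (hi.unique ht)
    · have hf : h i = true := decide_eq_true ht
      exact ht (hf ▸ hi)
  obtain ⟨s, hs, hel⟩ := exists_finCode ((Finset.range (N + 1)).image fun i => pr i (h i).toNat)
  have hmem : ∀ i b, Elem (pr i b) s ↔ i < N + 1 ∧ b = (h i).toNat := by
    intro i b
    rw [hel, Finset.mem_image]
    constructor
    · rintro ⟨i', hi', he⟩
      obtain ⟨rfl, rfl⟩ := pr_inj he
      exact ⟨by simpa using hi', rfl⟩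
    · rintro ⟨hi, rfl⟩
      exact ⟨i, by simpa using hi, rfl⟩
  have hbin : BinSeq s (N + 1) := by
    refine ⟨hs, fun x hx => ?_, fun i hi => ?_⟩
    · obtain ⟨i, hi, rfl⟩ := Finset.mem_image.1 ((hel x).1 hx)
      refine ⟨i, by simpa using hi, ?_⟩
      cases h i
      exacts [Or.inl rfl, Or.inr rfl]
    · rw [hmem, hmem]
      cases h i <;> simp [hi]
  refine ⟨s, ⟨N + 1, hbin, fun i _ t _ b hd hx => ?_⟩, hbin.length_le⟩
  have hb := ((hmem i _).1 hx).2
  have : b = h i := by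
    revert hb
    cases b <;> cases h i <;> simp
  exact hh i (this ▸ ⟨t, hd⟩)

theorem mem_diagTree_of_subset {s s' l' : ℕ} (hs : s ∈ diagTree) (hs' : BinSeq s' l')
    (h : ∀ x, Elem x s' → Elem x s) : s' ∈ diagTree := by
  obtain ⟨l, hl, H⟩ := hs
  have hle := hl.le_of_subset hs' h
  exact ⟨l', hs', fun i hi t ht b hd hx => H i (by omega) t (by omega) b hd (h _ hx)⟩

/-- A path through the tree computes a separation. -/
theorem not_nonSep_of_path {X : ℕ → ℕ} {P : Set ℕ} (hP : Rec X P)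
    (hfun : ∀ i, (pr i 0 ∈ P ∨ pr i 1 ∈ P) ∧ ¬(pr i 0 ∈ P ∧ pr i 1 ∈ P))
    (hpath : ∀ l, ∃ s, BinSeq s l ∧ (∀ x, Elem x s → x ∈ P) ∧ s ∈ diagTree) : ¬NonSep X := by
  classical
  have hp : Primrec fun q : ℕ × Bool => pr q.1 1 := primrec_pr.comp Primrec.fst (Primrec.const 1)
  have hb : ∀ b, PrimrecPred fun q : ℕ × Bool => q.2 = b := fun b =>
    Primrec.eq.comp Primrec.snd (Primrec.const b)
  refine not_not.2 ⟨fun i => decide (pr i 1 ∈ P), ?_, fun i ⟨t, ht⟩ => ?_⟩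
  · refine (((Sig.of_primrec (hb true)).and (hP.1.comp hp)).or
      ((Sig.of_primrec (hb false)).and (hP.2.comp hp))).of_iff fun q => ?_
    obtain ⟨i, b⟩ := q
    by_cases h : pr i 1 ∈ P <;> cases b <;> simp [h]
  -- With this length, both the input `i` and the stage `t` at which it halts fall within the range
  -- inspected by `diagTree`, so the halting value is excluded from `s`.
  · obtain ⟨s, hs, hsP, l, hl, H⟩ := hpath (max i t + 1)
    have hle := hl.le_of_subset hs fun _ h => h
    have hno := H i (by omega) t (by omega) _ ht
    have hone := (hs.2.2 i (by omega)).1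
    by_cases h : pr i 1 ∈ P
    · simp only [h, decide_true, Bool.toNat_true] at hno
      exact (hfun i).2 ⟨hsP _ (hone.resolve_right hno), h⟩
    · simp only [h, decide_false, Bool.toNat_false] at hno
      exact h (hsP _ (hone.resolve_left hno))

theorem not_true_WKL {X : ℕ → ℕ → ℕ} (hX : ∀ n, NonSep (X n)) (ν : ℕ → ℕ) (μ : ℕ → Set ℕ) :
    ¬WKL.True (ideal X) ν μ := by
  intro h
  rw [WKL, true_allS] at h
  have hT := h diagTree ⟨0, Rec.of_primrec primrecPred_diagTree⟩
  rw [true_imp, true_and, true_exS] at hT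
  obtain ⟨P, ⟨n, hP⟩, hpath⟩ := hT (by
    constructor
    · simp only [isTree, true_and, true_allN, true_exN, true_imp, true_mem, true_isBinSeq,
        true_elem, val_var, cons_zero, cons_one, cons_two]
      exact ⟨fun s ⟨l, hl, _⟩ => ⟨l, hl⟩,
        fun s s' ⟨hs, ⟨l', hl'⟩, hsub⟩ => mem_diagTree_of_subset hs hl' hsub⟩
    · simp only [infinite, true_and, true_allN, true_exN, true_mem, true_lt, val_var, cons_zero,
        cons_one]
      exact fun N => (diagTree_unbounded N).imp fun s h => ⟨h.2, h.1⟩)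
  simp only [isPath, isBinFun, true_and, true_allN, true_exN, true_imp, true_mem, true_isBinSeq,
    true_elem, exactlyOne, true_or, true_neg, val_pair, val_var, val_zero, val_one, cons_zero,
    cons_one] at hpath
  exact not_nonSep_of_path hP hpath.1.2 hpath.2 (hX n)

end SOA

theorem corollary1p5 : ¬ SOA.Provable (SOA.RCA0 ∪ {SOA.RT22}) SOA.WKL := by
  intro h
  obtain ⟨X, hns, hmono, hsol⟩ := SOA.exists_oracles
  have hempty : (∅ : Set ℕ) ∈ SOA.ideal X := ⟨0, SOA.Rec.of_finite Set.finite_empty⟩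
  refine SOA.not_true_WKL hns (fun _ => 0) (fun _ => ∅)
    (h.sound (fun φ hφ ν μ hμ => ?_) _ _ fun _ => hempty)
  rcases hφ with hφ | rfl
  · exact SOA.true_RCA0 hmono hφ ν μ hμ
  · exact SOA.true_RT22 hsol ν μ
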